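/- Fix a set of unary operators $op_1$ and binary operators $op_2$, denoting smooth total functions $\mathbb R\to\mathbb R$ and $\mathbb R\times\mathbb R\to\mathbb R$, containing $+$ and $*$ and closed under (partial) differentiation: there are operators $\partial op_1$, $\partial_1 op_2$, $\partial_2 op_2$ that denote the derivative of $op_1$ and the partial derivatives of $op_2$. *Source language.* Types: $T ::= \mathbb R \mid T\times T \mid \mathrm{Array}_{\mathbb R}^n$. Terms: variables, real constants, $\mathrm{let}\ x=e_1\ \mathrm{in}\ e_2$, pairs and projections, $op_1\,e$, $e_1\,op_2\,e_2$, $\mathrm{map2}\,(x,y.e_1)\,e_2\,e_3$ (pointwise on two arrays of equal size; $e_1$ may use the context), and $\mathrm{reduce}\,(x,y.e_1)\,e_2\,e_3$ (fold left over $e_3$ from $e_2$; $x,y\vdash e_1$ has no other free variables). As usual for $\mathrm{reduce}$, in each of its occurrences $e_1$ denotes an associative operation and $e_2$ denotes a unit of it. A term $\Gamma\vdash e:A$ denotes a function $[\![e]\!]:[\![\Gamma]\!]\to[\![A]\!]$. The *target language* adds $n$-tuples, $n$-ary functions, array literals, arrays of tuples, $\mathrm{scanl}$, $\mathrm{scanr}$,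 $\mathrm{shift1L}$, $\mathrm{shift1R}$; it is interpreted in diffeological spaces, with $[\![A\to B]\!]$ the space of smooth maps. *Source UNF.* A UNF term $u:\Gamma\to\Delta$ between contexts is a sequential composition $u_1;\dots;u_k$ of primitives: $\mathrm{var}_i:\Gamma\to\Gamma,A_i$; constants $\Gamma\to\Gamma,\mathbb R$; operators, projections $\pi_i$, $\mathrm{map2}_{x,y.e_1}$ and $\mathrm{reduce}_{x,y.e_1;e_2}$, each of which reads its arguments off the end of its context and returns the whole context together with the result; $\mathrm{pair}:\Gamma,A,B\to\Gamma,A\times B$; and $\mathrm{proj}:\Gamma,\Theta,A\to\Gamma,A$. A source term $\Gamma\vdash e:A$ is compiled to $\mathrm{UNF}(e):\Gamma\to\Gamma,A$ by compiling the arguments from left to right (each in the context extended by the values of the previous ones; the initial value $e_2$ of a $\mathrm{reduce}$ is kept inside the primitive), applying the primitive, and removing the arguments by $\mathrm{proj}$; a $\mathrm{let}$ is $\mathrm{UNF}(e_1);\mathrm{UNF}(e_2);\mathrm{proj}$. *Reverse mode.* For a type $\rho$, $\mathcal D_\rho$ sends a context $\Gamma=A_1,\dots,A_n$ to $A_1,\dots,A_n,\,Y:(A_1\times\dots\times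 A_n\to\rho)$, a primitive $p$ to $\langle p,\ Y\circ J^Tp\rangle$, with $J^Tp$ the symbol for the transposed Jacobian of $p$, and preserves sequential composition. *Back to the target language.* $\mathrm{UNF}^{-1}$ sends sequential composition to $\mathrm{let}$, each primitive to the corresponding target term, $\circ$ to a lambda abstraction, and each symbol $J^Tp$ to an explicit target term: for operators this uses $\partial op_1,\partial_1op_2,\partial_2op_2$; for $\mathrm{map2}$ and $\mathrm{reduce}$ it uses array operations (with $\mathrm{scanl}$, $\mathrm{scanr}$ and the shifts for $\mathrm{reduce}$) and the gradient terms $\nabla e_1$ of the function argument, given by the direct reverse-mode transformation. The result is projected to the last value and the continuation, so that for $\Gamma\vdash e:A$ the term $\mathrm{UNF}^{-1}(\mathcal D_\rho(\mathrm{UNF}(e)))$ has type $A\times(\Gamma\times A\to\rho)$ in the context $\Gamma,\ Y:\Gamma\to\rho$. **Proposition.** Let $x_1:\mathbb R,\dots,x_n:\mathbb R\vdash e:\mathbb R$ be a source term, and let $\rho=\mathbb R^n$. Then $\langle \mathrm{Id}_{\mathbb R^n},[\![e]\!]\rangle:\mathbb R^n\to\mathbb R^{n+1}$ is smooth, and for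 all $(x_1,\dots,x_n)\in\mathbb R^n$ $$[\![\pi_2\,\mathrm{UNF}^{-1}(\mathcal D_\rho(\mathrm{UNF}(e)))]\!](x_1,\dots,x_n,\mathrm{Id}_{\mathbb R^n}) \;=\; J^T_{(x_1,\dots,x_n)}\langle \mathrm{Id}_{\mathbb R^n},[\![e]\!]\rangle ,$$ an equality of maps $\mathbb R^{n+1}\to\mathbb R^n$, the right-hand side being multiplication by the transpose of the Jacobian matrix at $(x_1,\dots,x_n)$. -/

import Mathlib

open scoped ContDiff Matrix

universe u

namespace RevAD

noncomputable section

/-! ### Diffeological spaces: products, powers, spaces of smooth maps -/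

section Diffeological

open Diffeology

/-- The one-point diffeological space. -/
instance unitDiffeology : DiffeologicalSpace PUnit.{1} where
  plots _ := Set.univ
  constant_plots _ := trivial
  plot_reparam _ _ := trivial
  locality _ := trivial

/-- The product diffeology. -/
instance prodDiffeology (X Y : Type) [DiffeologicalSpace X] [DiffeologicalSpace Y] :
    DiffeologicalSpace (X × Y) where
  plots _ := {p | IsPlot (fun t => (p t).1) ∧ IsPlot (fun t => (p t).2)}
  constant_plots _ := ⟨isPlot_const, isPlot_const⟩
  plot_reparam hp hf := ⟨isPlot_reparam hp.1 hf, isPlot_reparam hp.2 hf⟩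
  locality {n p} hp := by
    constructor
    · refine DiffeologicalSpace.locality fun x => ?_
      obtain ⟨v, hv, hx, h⟩ := hp x
      exact ⟨v, hv, hx, fun h1 h2 => (h h1 h2).1⟩
    · refine DiffeologicalSpace.locality fun x => ?_
      obtain ⟨v, hv, hx, h⟩ := hp x
      exact ⟨v, hv, hx, fun h1 h2 => (h h1 h2).2⟩

/-- The product diffeology on a power. -/
instance powDiffeology (ι X : Type) [DiffeologicalSpace X] : DiffeologicalSpace (ι → X) where
  plots _ := {p | ∀ i, IsPlot (fun t => p t i)}
  constant_plots _ _ := isPlot_const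
  plot_reparam hp hf i := isPlot_reparam (hp i) hf
  locality {n p} hp i := by
    refine DiffeologicalSpace.locality fun x => ?_
    obtain ⟨v, hv, hx, h⟩ := hp x
    exact ⟨v, hv, hx, fun h1 h2 => h h1 h2 i⟩

/-- Smooth maps between diffeological spaces. -/
@[ext]
structure SmoothMap (X Y : Type) [DiffeologicalSpace X] [DiffeologicalSpace Y] where
  toFun : X → Y
  smooth : DSmooth toFun

instance (X Y : Type) [DiffeologicalSpace X] [DiffeologicalSpace Y] :
    CoeFun (SmoothMap X Y) (fun _ => X → Y) where
  coe := SmoothMap.toFun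

variable {X Y Z : Type} [DiffeologicalSpace X] [DiffeologicalSpace Y] [DiffeologicalSpace Z]

theorem dsmooth_fst {f : X → Y × Z} (hf : DSmooth f) : DSmooth (fun x => (f x).1) :=
  fun n p hp => (hf n p hp).1

theorem dsmooth_snd {f : X → Y × Z} (hf : DSmooth f) : DSmooth (fun x => (f x).2) :=
  fun n p hp => (hf n p hp).2

theorem dsmooth_mk {f : X → Y} {g : X → Z} (hf : DSmooth f) (hg : DSmooth g) :
    DSmooth (fun x => (f x, g x)) :=
  fun n p hp => ⟨hf n p hp, hg n p hp⟩

theorem dsmooth_pi {ι : Type} {f : X → ι → Y} (hf : ∀ i, DSmooth (fun x => f x i)) : DSmooth f :=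
  fun n p hp i => hf i n p hp

theorem dsmooth_apply {ι : Type} {f : X → ι → Y} (hf : DSmooth f) (i : ι) :
    DSmooth (fun x => f x i) :=
  fun n p hp => hf n p hp i

/-- The functional diffeology: a plot is a family of smooth maps that is jointly smooth. -/
instance mapDiffeology (X Y : Type) [DiffeologicalSpace X] [DiffeologicalSpace Y] :
    DiffeologicalSpace (SmoothMap X Y) where
  plots n := {p | ∀ (m : ℕ) (q : EuclideanSpace ℝ (Fin m) → EuclideanSpace ℝ (Fin n))
    (r : EuclideanSpace ℝ (Fin m) → X), IsPlot q → IsPlot r → IsPlot (fun t => p (q t) (r t))}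
  constant_plots f _ _ _ _ hr := f.smooth _ _ hr
  plot_reparam hp hf m q r hq hr := hp m _ r (hf.dSmooth _ _ hq) hr
  locality {_ _} hp m q r hq hr := by
    refine DiffeologicalSpace.locality fun x => ?_
    obtain ⟨v, hv, hx, h⟩ := hp (q x)
    have hqc : ContDiff ℝ ∞ q := hq.contDiff
    refine ⟨q ⁻¹' v, hv.preimage hqc.continuous, hx, fun {k f} h1 h2 => ?_⟩
    exact h (f := q ∘ f) h1 (hqc.comp h2) k id (r ∘ f) isPlot_id (isPlot_reparam hr h2)

theorem isPlot_map_iff {n : ℕ} (p : EuclideanSpace ℝ (Fin n) → SmoothMap X Y) :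
    IsPlot p ↔ DSmooth (fun ux : EuclideanSpace ℝ (Fin n) × X => p ux.1 ux.2) :=
  ⟨fun h m q hq => h m _ _ hq.1 hq.2, fun h m q r hq hr => h m (fun t => (q t, r t)) ⟨hq, hr⟩⟩

theorem dsmooth_app {f : X → SmoothMap Y Z} {a : X → Y} (hf : DSmooth f) (ha : DSmooth a) :
    DSmooth (fun x => f x (a x)) :=
  fun n p hp => hf n p hp n id (a ∘ p) isPlot_id (ha n p hp)

theorem dsmooth_curry {f : X × Y → Z} (hf : DSmooth f) :
    DSmooth (fun x => (⟨fun y => f (x, y), hf.comp (dsmooth_mk dSmooth_const dSmooth_id)⟩ :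
      SmoothMap Y Z)) :=
  fun n p hp m q r hq hr => hf m (fun t => (p (q t), r t)) ⟨hp.dSmooth _ _ hq, hr⟩

theorem dsmooth_real₂ {g : ℝ → ℝ → ℝ} (hg : ContDiff ℝ ∞ (fun p : ℝ × ℝ => g p.1 p.2))
    {a b : X → ℝ} (ha : DSmooth a) (hb : DSmooth b) : DSmooth (fun x => g (a x) (b x)) :=
  fun n p hp => (hg.comp ((ha n p hp).contDiff.prodMk (hb n p hp).contDiff)).isPlot

/-- The identity, as a smooth map. -/
def SmoothMap.id (X : Type) [DiffeologicalSpace X] : SmoothMap X X := ⟨fun x => x, dSmooth_id⟩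

/-! ### Array operations -/

/-- Fold left over an array. -/
def foldArr {A B : Type} (f : A → B → A) (a : A) : (n : ℕ) → (Fin n → B) → A
  | 0, _ => a
  | n + 1, v => f (foldArr f a n (fun i => v i.castSucc)) (v (Fin.last n))

/-- Scan left: the array of all intermediate results of a fold left. -/
def scanlArr {A B : Type} (f : A → B → A) (a : A) (n : ℕ) (v : Fin n → B) : Fin (n + 1) → A :=
  fun i => foldArr f a i.val (fun j => v (Fin.castLE (Nat.lt_succ_iff.mp i.isLt) j))

/-- Scan right: fold left reading the array from right to left, with the intermediate results
stored from right to left. -/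
def scanrArr {A B : Type} (f : A → B → A) (a : A) (n : ℕ) (v : Fin n → B) : Fin (n + 1) → A :=
  fun i => scanlArr f a n (fun j => v j.rev) i.rev

/-- Forget the first element (if there is one). -/
def shiftLArr {A : Type} (n : ℕ) (v : Fin n → A) : Fin (n - 1) → A :=
  fun i => v ⟨i.val + 1, by have := i.isLt; omega⟩

/-- Forget the last element (if there is one). -/
def shiftRArr {A : Type} (n : ℕ) (v : Fin n → A) : Fin (n - 1) → A :=
  fun i => v ⟨i.val, by have := i.isLt; omega⟩

theorem dsmooth_fold {W : Type} [DiffeologicalSpace W] {f : X → Y → W → Y} {a : X → Y}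
    (hf : DSmooth (fun p : (X × Y) × W => f p.1.1 p.1.2 p.2)) (ha : DSmooth a) (n : ℕ) :
    ∀ {v : X → Fin n → W}, DSmooth v → DSmooth (fun x => foldArr (f x) (a x) n (v x)) := by
  induction n with
  | zero => intro _ _; exact ha
  | succ n ih =>
    intro v hv
    have h1 := ih (v := fun x i => v x i.castSucc) (dsmooth_pi fun i => dsmooth_apply hv _)
    exact hf.comp (dsmooth_mk (dsmooth_mk dSmooth_id h1) (dsmooth_apply hv (Fin.last n)))

theorem dsmooth_scanl {W : Type} [DiffeologicalSpace W] {f : X → Y → W → Y} {a : X → Y}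
    (hf : DSmooth (fun p : (X × Y) × W => f p.1.1 p.1.2 p.2)) (ha : DSmooth a) (n : ℕ)
    {v : X → Fin n → W} (hv : DSmooth v) : DSmooth (fun x => scanlArr (f x) (a x) n (v x)) :=
  dsmooth_pi fun _ => dsmooth_fold hf ha _ (dsmooth_pi fun _ => dsmooth_apply hv _)

theorem dsmooth_scanr {W : Type} [DiffeologicalSpace W] {f : X → Y → W → Y} {a : X → Y}
    (hf : DSmooth (fun p : (X × Y) × W => f p.1.1 p.1.2 p.2)) (ha : DSmooth a) (n : ℕ)
    {v : X → Fin n → W} (hv : DSmooth v) : DSmooth (fun x => scanrArr (f x) (a x) n (v x)) :=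
  dsmooth_pi fun _ => dsmooth_apply
    (dsmooth_scanl hf ha n (v := fun x j => v x j.rev) (dsmooth_pi fun _ => dsmooth_apply hv _)) _

end Diffeological

/-- Bundled diffeological spaces. -/
structure DiffSp where
  carrier : Type
  str : DiffeologicalSpace carrier

instance : CoeSort DiffSp Type := ⟨DiffSp.carrier⟩

instance (X : DiffSp) : DiffeologicalSpace X := X.str

/-! ### Scalar operations -/

/-- A set of unary and binary scalar operations that denote smooth total functions, that contains
`+` and `*` and that is closed under (partial) differentiation. -/
structure Signature where
  Op1 : Type u
  Op2 : Type u
  den1 : Op1 → ℝ → ℝ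
  den2 : Op2 → ℝ → ℝ → ℝ
  smooth1 : ∀ f, ContDiff ℝ ∞ (den1 f)
  smooth2 : ∀ g, ContDiff ℝ ∞ (fun p : ℝ × ℝ => den2 g p.1 p.2)
  add : Op2
  mul : Op2
  den_add : ∀ x y, den2 add x y = x + y
  den_mul : ∀ x y, den2 mul x y = x * y
  d : Op1 → Op1
  d₁ : Op2 → Op2
  d₂ : Op2 → Op2
  den_d : ∀ f x, den1 (d f) x = deriv (den1 f) x
  den_d₁ : ∀ g x y, den2 (d₁ g) x y = deriv (fun t => den2 g t y) x
  den_d₂ : ∀ g x y, den2 (d₂ g) x y = deriv (fun t => den2 g x t) y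

/-! ### Contexts, variables, types -/

/-- Contexts, extended on the right. -/
inductive Ctx (T : Type) : Type
  | nil : Ctx T
  | snoc : Ctx T → T → Ctx T

infixl:65 " ▹ " => Ctx.snoc

namespace Ctx

def append {T : Type} (Γ : Ctx T) : Ctx T → Ctx T
  | nil => Γ
  | Δ ▹ A => append Γ Δ ▹ A

def map {T U : Type} (f : T → U) : Ctx T → Ctx U
  | nil => nil
  | Γ ▹ A => map f Γ ▹ f A

end Ctx

/-- Typed de Bruijn variables: `Var Γ A` is the set of positions of `Γ` that hold the type `A`. -/
inductive Var {T : Type} : Ctx T → T → Type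
  | zero {Γ : Ctx T} {A : T} : Var (Γ ▹ A) A
  | succ {Γ : Ctx T} {A B : T} : Var Γ A → Var (Γ ▹ B) A

/-- Renamings. -/
def Ren {T : Type} (Γ Δ : Ctx T) : Type := ∀ ⦃A : T⦄, Var Γ A → Var Δ A

namespace Ren

variable {T : Type}

def id (Γ : Ctx T) : Ren Γ Γ := fun _ i => i

/-- Weakening after a renaming. -/
def wk {Γ Δ : Ctx T} {B : T} (r : Ren Γ Δ) : Ren Γ (Δ ▹ B) := fun _ i => .succ (r i)

def lift {Γ Δ : Ctx T} {B : T} (r : Ren Γ Δ) : Ren (Γ ▹ B) (Δ ▹ B) := fun _ i =>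
  match i with
  | .zero => .zero
  | .succ j => .succ (r j)

def liftN {Γ Δ : Ctx T} (r : Ren Γ Δ) : (Θ : Ctx T) → Ren (Γ.append Θ) (Δ.append Θ)
  | .nil => r
  | Θ ▹ _ => lift (liftN r Θ)

def inl {Γ : Ctx T} : (Θ : Ctx T) → Ren Γ (Γ.append Θ)
  | .nil => id Γ
  | Θ ▹ _ => wk (inl Θ)

def inr {Γ : Ctx T} : (Θ : Ctx T) → Ren Θ (Γ.append Θ)
  | .nil => fun _ i => nomatch i
  | Θ ▹ _ => lift (inr Θ)

end Ren

/-- Types of the source language. -/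
inductive STy : Type
  | real : STy
  | prod : STy → STy → STy
  | arr : ℕ → STy

/-- Types of the target language. An `n`-tuple type is an iterated product, see `tup`. -/
inductive Ty : Type
  | real : Ty
  | unit : Ty
  | prod : Ty → Ty → Ty
  | arr : Ty → ℕ → Ty
  | fn : Ty → Ty → Ty

abbrev SCtx : Type := Ctx STy
abbrev TCtx : Type := Ctx Ty

/-- Source types are target types. -/
def STy.emb : STy → Ty
  | .real => .real
  | .prod A B => .prod A.emb B.emb
  | .arr n => .arr .real n

def SCtx.emb (Γ : SCtx) : TCtx := Γ.map STy.emb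

/-- The tuple type `A₁ × ⋯ × Aₙ` of a context `A₁, …, Aₙ`. -/
def tup : TCtx → Ty
  | .nil => .unit
  | Γ ▹ A => .prod (tup Γ) A

/-- Denotation of types in diffeological spaces. -/
def Ty.den : Ty → DiffSp
  | .real => ⟨ℝ, inferInstance⟩
  | .unit => ⟨PUnit, inferInstance⟩
  | .prod A B => ⟨A.den × B.den, inferInstance⟩
  | .arr A n => ⟨Fin n → A.den, inferInstance⟩
  | .fn A B => ⟨SmoothMap A.den B.den, inferInstance⟩

/-- Denotation of contexts: a context denotes the product of its types. -/
abbrev TCtx.Env (Γ : TCtx) : DiffSp := (tup Γ).den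

/-- Assignment of target variables to source variables. -/
def SRen (Γ : SCtx) (Δ : TCtx) : Type := ∀ ⦃A : STy⦄, Var Γ A → Var Δ A.emb

namespace SRen

def id : (Γ : SCtx) → SRen Γ (SCtx.emb Γ)
  | .nil => fun _ i => nomatch i
  | Γ ▹ _ => fun _ i =>
    match i with
    | .zero => .zero
    | .succ j => .succ (id Γ j)

def andThen {Γ : SCtx} {Δ Θ : TCtx} (v : SRen Γ Δ) (r : Ren Δ Θ) : SRen Γ Θ := fun _ i => r (v i)

def precomp {Γ Γ' : SCtx} {Δ : TCtx} (s : Ren Γ Γ') (v : SRen Γ' Δ) : SRen Γ Δ := fun _ i => v (s i)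

def wk {Γ : SCtx} {Δ : TCtx} {B : Ty} (v : SRen Γ Δ) : SRen Γ (Δ ▹ B) := fun _ i => .succ (v i)

def lift {Γ : SCtx} {Δ : TCtx} {B : STy} (v : SRen Γ Δ) : SRen (Γ ▹ B) (Δ ▹ B.emb) := fun _ i =>
  match i with
  | .zero => .zero
  | .succ j => .succ (v j)

def cons {Γ : SCtx} {Δ : TCtx} {B : STy} (v : SRen Γ Δ) (k : Var Δ B.emb) : SRen (Γ ▹ B) Δ :=
  fun _ i =>
  match i with
  | .zero => k
  | .succ j => v j

def empty (Δ : TCtx) : SRen .nil Δ := fun _ i => nomatch i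

end SRen

/-! ### The source language -/

/-- Well-typed terms of the source language. -/
inductive Src (S : Signature.{u}) : SCtx → STy → Type u
  | var {Γ : SCtx} {A : STy} : Var Γ A → Src S Γ A
  | cst {Γ : SCtx} : ℝ → Src S Γ .real
  | let_ {Γ : SCtx} {A B : STy} : Src S Γ A → Src S (Γ ▹ A) B → Src S Γ B
  | pair {Γ : SCtx} {A B : STy} : Src S Γ A → Src S Γ B → Src S Γ (.prod A B)
  | fst {Γ : SCtx} {A B : STy} : Src S Γ (.prod A B) → Src S Γ A
  | snd {Γ : SCtx} {A B : STy} : Src S Γ (.prod A B) → Src S Γ B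
  | op1 {Γ : SCtx} : S.Op1 → Src S Γ .real → Src S Γ .real
  | op2 {Γ : SCtx} : S.Op2 → Src S Γ .real → Src S Γ .real → Src S Γ .real
  | map2 {Γ : SCtx} {n : ℕ} : Src S (Γ ▹ .real ▹ .real) .real → Src S Γ (.arr n) →
      Src S Γ (.arr n) → Src S Γ (.arr n)
  | reduce {Γ : SCtx} {n : ℕ} : Src S (.nil ▹ .real ▹ .real) .real → Src S Γ .real →
      Src S Γ (.arr n) → Src S Γ .real

/-- The value of a source variable in an environment. -/
def Var.get : {Γ : SCtx} → {A : STy} → Var Γ A → TCtx.Env Γ.emb → A.emb.den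
  | _, _, .zero => fun γ => γ.2
  | _, _, .succ i => fun γ => Var.get i γ.1

namespace Src

variable {S : Signature.{u}}

/-- Denotation of source terms. -/
def den {Γ : SCtx} {A : STy} : Src S Γ A → TCtx.Env Γ.emb → A.emb.den
  | var i => i.get
  | cst c => fun _ => c
  | let_ e₁ e₂ => fun γ => e₂.den (γ, e₁.den γ)
  | pair e₁ e₂ => fun γ => (e₁.den γ, e₂.den γ)
  | fst e => fun γ => (e.den γ).1
  | snd e => fun γ => (e.den γ).2
  | op1 f e => fun γ => S.den1 f (e.den γ)
  | op2 g e₁ e₂ => fun γ => S.den2 g (e₁.den γ) (e₂.den γ)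
  | map2 e₁ e₂ e₃ => fun γ i => e₁.den ((γ, e₂.den γ i), e₃.den γ i)
  | reduce (n := n) e₁ e₂ e₃ => fun γ =>
      foldArr (fun a b : ℝ => e₁.den ((PUnit.unit, a), b)) (e₂.den γ) n (e₃.den γ)

/-- The standing assumption on `reduce`: in every subterm `reduce (x,y.e₁) e₂ e₃` the operation
`x, y ⊢ e₁` is associative and `Γ ⊢ e₂` denotes a unit of it. -/
def ReduceOK {Γ : SCtx} {A : STy} : Src S Γ A → Prop
  | var _ => True
  | cst _ => True
  | let_ e₁ e₂ => e₁.ReduceOK ∧ e₂.ReduceOK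
  | pair e₁ e₂ => e₁.ReduceOK ∧ e₂.ReduceOK
  | fst e => e.ReduceOK
  | snd e => e.ReduceOK
  | op1 _ e => e.ReduceOK
  | op2 _ e₁ e₂ => e₁.ReduceOK ∧ e₂.ReduceOK
  | map2 e₁ e₂ e₃ => e₁.ReduceOK ∧ e₂.ReduceOK ∧ e₃.ReduceOK
  | reduce e₁ e₂ e₃ =>
      (let m : ℝ → ℝ → ℝ := fun a b => e₁.den ((PUnit.unit, a), b)
       (∀ a b c, m (m a b) c = m a (m b c)) ∧
       ∀ γ (a : ℝ), m (e₂.den γ) a = a ∧ m a (e₂.den γ) = a) ∧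
      e₁.ReduceOK ∧ e₂.ReduceOK ∧ e₃.ReduceOK

def rename {Γ : SCtx} {A : STy} : Src S Γ A → {Δ : SCtx} → Ren Γ Δ → Src S Δ A
  | var i, _, r => var (r i)
  | cst c, _, _ => cst c
  | let_ e₁ e₂, _, r => let_ (e₁.rename r) (e₂.rename r.lift)
  | pair e₁ e₂, _, r => pair (e₁.rename r) (e₂.rename r)
  | fst e, _, r => fst (e.rename r)
  | snd e, _, r => snd (e.rename r)
  | op1 f e, _, r => op1 f (e.rename r)
  | op2 g e₁ e₂, _, r => op2 g (e₁.rename r) (e₂.rename r)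
  | map2 e₁ e₂ e₃, _, r => map2 (e₁.rename r.lift.lift) (e₂.rename r) (e₃.rename r)
  | reduce e₁ e₂ e₃, _, r => reduce e₁ (e₂.rename r) (e₃.rename r)

end Src

/-! ### The target language -/

/-- Well-typed terms of the target language. Arrays may have elements of any type, because the
reverse derivative of `map2` uses arrays of tuples. -/
inductive Tm (S : Signature.{u}) : TCtx → Ty → Type u
  | var {Γ : TCtx} {A : Ty} : Var Γ A → Tm S Γ A
  | cst {Γ : TCtx} : ℝ → Tm S Γ .real
  | let_ {Γ : TCtx} {A B : Ty} : Tm S Γ A → Tm S (Γ ▹ A) B → Tm S Γ B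
  | unit {Γ : TCtx} : Tm S Γ .unit
  | pair {Γ : TCtx} {A B : Ty} : Tm S Γ A → Tm S Γ B → Tm S Γ (.prod A B)
  | fst {Γ : TCtx} {A B : Ty} : Tm S Γ (.prod A B) → Tm S Γ A
  | snd {Γ : TCtx} {A B : Ty} : Tm S Γ (.prod A B) → Tm S Γ B
  | op1 {Γ : TCtx} : S.Op1 → Tm S Γ .real → Tm S Γ .real
  | op2 {Γ : TCtx} : S.Op2 → Tm S Γ .real → Tm S Γ .real → Tm S Γ .real
  | map2 {Γ : TCtx} {A B C : Ty} {n : ℕ} : Tm S (Γ ▹ A ▹ B) C → Tm S Γ (.arr A n) →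
      Tm S Γ (.arr B n) → Tm S Γ (.arr C n)
  | reduce {Γ : TCtx} {A : Ty} {n : ℕ} : Tm S (Γ ▹ A ▹ A) A → Tm S Γ A → Tm S Γ (.arr A n) →
      Tm S Γ A
  /-- `fun (x₁, …, xₙ) -> e` -/
  | lam {Γ : TCtx} {B : Ty} (Δ : TCtx) : Tm S (Γ.append Δ) B → Tm S Γ (.fn (tup Δ) B)
  /-- application of a function to the tuple of its arguments -/
  | app {Γ : TCtx} {A B : Ty} : Tm S Γ (.fn A B) → Tm S Γ A → Tm S Γ B
  /-- array literal `[e₁, …, eₙ]` -/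
  | lit {Γ : TCtx} {A : Ty} {n : ℕ} : (Fin n → Tm S Γ A) → Tm S Γ (.arr A n)
  | scanl {Γ : TCtx} {n : ℕ} : Tm S (Γ ▹ .real ▹ .real) .real → Tm S Γ .real →
      Tm S Γ (.arr .real n) → Tm S Γ (.arr .real (n + 1))
  | scanr {Γ : TCtx} {n : ℕ} : Tm S (Γ ▹ .real ▹ .real) .real → Tm S Γ .real →
      Tm S Γ (.arr .real n) → Tm S Γ (.arr .real (n + 1))
  | shift1L {Γ : TCtx} {A : Ty} {n : ℕ} : Tm S Γ (.arr A n) → Tm S Γ (.arr A (n - 1))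
  | shift1R {Γ : TCtx} {A : Ty} {n : ℕ} : Tm S Γ (.arr A n) → Tm S Γ (.arr A (n - 1))

/-- Concatenation of environments. -/
def appendEnv {Γ : TCtx} : (Δ : TCtx) → TCtx.Env Γ → TCtx.Env Δ → TCtx.Env (Γ.append Δ)
  | .nil, γ, _ => γ
  | Δ ▹ _, γ, δ => (appendEnv Δ γ δ.1, δ.2)

theorem dsmooth_appendEnv {Γ : TCtx} (Δ : TCtx) :
    Diffeology.DSmooth (fun p : TCtx.Env Γ × TCtx.Env Δ => appendEnv Δ p.1 p.2) := by
  induction Δ with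
  | nil => exact dsmooth_fst Diffeology.dSmooth_id
  | snoc Δ A ih =>
    have h2 : Diffeology.DSmooth (fun p : TCtx.Env Γ × (TCtx.Env Δ × A.den) => p.2) :=
      dsmooth_snd Diffeology.dSmooth_id
    exact dsmooth_mk (ih.comp (dsmooth_mk (dsmooth_fst Diffeology.dSmooth_id) (dsmooth_fst h2)))
      (dsmooth_snd h2)

/-- The value of a target variable in an environment. -/
def Var.val : {Γ : TCtx} → {A : Ty} → Var Γ A → SmoothMap Γ.Env A.den
  | _, _, .zero => ⟨fun γ => γ.2, dsmooth_snd Diffeology.dSmooth_id⟩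
  | _, _, .succ i =>
    ⟨fun γ => i.val γ.1, i.val.smooth.comp (dsmooth_fst Diffeology.dSmooth_id)⟩

namespace Tm

variable {S : Signature.{u}}

theorem dsmooth_bind₂ {Γ A B C : Type} [DiffeologicalSpace Γ] [DiffeologicalSpace A]
    [DiffeologicalSpace B] [DiffeologicalSpace C] (f : SmoothMap ((Γ × A) × B) C) :
    Diffeology.DSmooth (fun p : (Γ × A) × B => f ((p.1.1, p.1.2), p.2)) := f.smooth

/-- Denotation of target terms, as smooth maps between diffeological spaces. -/
def den {Γ : TCtx} {A : Ty} : Tm S Γ A → SmoothMap Γ.Env A.den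
  | var i => i.val
  | cst c => ⟨fun _ => c, Diffeology.dSmooth_const⟩
  | let_ e₁ e₂ => ⟨fun γ => e₂.den (γ, e₁.den γ),
      e₂.den.smooth.comp (dsmooth_mk Diffeology.dSmooth_id e₁.den.smooth)⟩
  | unit => ⟨fun _ => PUnit.unit, Diffeology.dSmooth_const⟩
  | pair e₁ e₂ => ⟨fun γ => (e₁.den γ, e₂.den γ), dsmooth_mk e₁.den.smooth e₂.den.smooth⟩
  | fst e => ⟨fun γ => (e.den γ).1, dsmooth_fst e.den.smooth⟩
  | snd e => ⟨fun γ => (e.den γ).2, dsmooth_snd e.den.smooth⟩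
  | op1 f e => ⟨fun γ => S.den1 f (e.den γ), (S.smooth1 f).dSmooth.comp e.den.smooth⟩
  | op2 g e₁ e₂ => ⟨fun γ => S.den2 g (e₁.den γ) (e₂.den γ),
      dsmooth_real₂ (S.smooth2 g) e₁.den.smooth e₂.den.smooth⟩
  | map2 e₁ e₂ e₃ => ⟨fun γ i => e₁.den ((γ, e₂.den γ i), e₃.den γ i),
      dsmooth_pi fun i => e₁.den.smooth.comp (dsmooth_mk
        (dsmooth_mk Diffeology.dSmooth_id (dsmooth_apply e₂.den.smooth i))
        (dsmooth_apply e₃.den.smooth i))⟩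
  | reduce (n := n) e₁ e₂ e₃ =>
      ⟨fun γ => foldArr (fun a b => e₁.den ((γ, a), b)) (e₂.den γ) n (e₃.den γ),
        dsmooth_fold (dsmooth_bind₂ e₁.den) e₂.den.smooth n e₃.den.smooth⟩
  | lam Δ e => ⟨fun γ => ⟨fun δ => e.den (appendEnv Δ γ δ), e.den.smooth.comp
        ((dsmooth_appendEnv Δ).comp (dsmooth_mk Diffeology.dSmooth_const Diffeology.dSmooth_id))⟩,
      dsmooth_curry (e.den.smooth.comp (dsmooth_appendEnv Δ))⟩
  | app e₁ e₂ => ⟨fun γ => SmoothMap.toFun (e₁.den γ) (e₂.den γ),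
      dsmooth_app e₁.den.smooth e₂.den.smooth⟩
  | lit e => ⟨fun γ i => (e i).den γ, dsmooth_pi fun i => (e i).den.smooth⟩
  | scanl (n := n) e₁ e₂ e₃ =>
      ⟨fun γ => scanlArr (fun a b => e₁.den ((γ, a), b)) (e₂.den γ) n (e₃.den γ),
        dsmooth_scanl (dsmooth_bind₂ e₁.den) e₂.den.smooth n e₃.den.smooth⟩
  | scanr (n := n) e₁ e₂ e₃ =>
      ⟨fun γ => scanrArr (fun a b => e₁.den ((γ, a), b)) (e₂.den γ) n (e₃.den γ),
        dsmooth_scanr (dsmooth_bind₂ e₁.den) e₂.den.smooth n e₃.den.smooth⟩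
  | shift1L (n := n) e => ⟨fun γ => shiftLArr n (e.den γ),
      dsmooth_pi fun _ => dsmooth_apply e.den.smooth _⟩
  | shift1R (n := n) e => ⟨fun γ => shiftRArr n (e.den γ),
      dsmooth_pi fun _ => dsmooth_apply e.den.smooth _⟩

def rename {Γ : TCtx} {A : Ty} : Tm S Γ A → {Δ : TCtx} → Ren Γ Δ → Tm S Δ A
  | var i, _, r => var (r i)
  | cst c, _, _ => cst c
  | let_ e₁ e₂, _, r => let_ (e₁.rename r) (e₂.rename r.lift)
  | unit, _, _ => unit
  | pair e₁ e₂, _, r => pair (e₁.rename r) (e₂.rename r)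
  | fst e, _, r => fst (e.rename r)
  | snd e, _, r => snd (e.rename r)
  | op1 f e, _, r => op1 f (e.rename r)
  | op2 g e₁ e₂, _, r => op2 g (e₁.rename r) (e₂.rename r)
  | map2 e₁ e₂ e₃, _, r => map2 (e₁.rename r.lift.lift) (e₂.rename r) (e₃.rename r)
  | reduce e₁ e₂ e₃, _, r => reduce (e₁.rename r.lift.lift) (e₂.rename r) (e₃.rename r)
  | lam Θ e, _, r => lam Θ (e.rename (r.liftN Θ))
  | app e₁ e₂, _, r => app (e₁.rename r) (e₂.rename r)
  | lit e, _, r => lit (fun i => (e i).rename r)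
  | scanl e₁ e₂ e₃, _, r => scanl (e₁.rename r.lift.lift) (e₂.rename r) (e₃.rename r)
  | scanr e₁ e₂ e₃, _, r => scanr (e₁.rename r.lift.lift) (e₂.rename r) (e₃.rename r)
  | shift1L e, _, r => shift1L (e.rename r)
  | shift1R e, _, r => shift1R (e.rename r)

/-- Weakening by one variable. -/
def wk {Γ : TCtx} {A B : Ty} (t : Tm S Γ A) : Tm S (Γ ▹ B) A := t.rename (Ren.id Γ).wk

/-- Weakening by two variables. -/
def wk₂ {Γ : TCtx} {A B C : Ty} (t : Tm S Γ A) : Tm S (Γ ▹ B ▹ C) A := t.wk.wk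

/-- The most recent variable. -/
def v0 {Γ : TCtx} {A : Ty} : Tm S (Γ ▹ A) A := var .zero

/-- The variable bound before the most recent one. -/
def v1 {Γ : TCtx} {A B : Ty} : Tm S (Γ ▹ A ▹ B) A := var (.succ .zero)

/-- The variable `x` after `let (x, Y) = … in let (x', Y') = … in`. -/
def v4 {Γ : TCtx} {A B C D E : Ty} : Tm S (Γ ▹ A ▹ B ▹ C ▹ D ▹ E) A :=
  var (.succ (.succ (.succ (.succ .zero))))

/-- `let (x, Y) = e in b`; the pair itself is bound as well. -/
def letPair {Γ : TCtx} {A B C : Ty} (e : Tm S Γ (.prod A B))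
    (b : Tm S (Γ ▹ .prod A B ▹ A ▹ B) C) : Tm S Γ C :=
  let_ e (let_ (fst v0) (let_ (snd v1) b))

/-- `let x₁, …, xₙ = e in b`, where `e` is an `n`-tuple. -/
def letTup {Γ : TCtx} {C : Ty} (Δ : TCtx) (e : Tm S Γ (tup Δ)) (b : Tm S (Γ.append Δ) C) :
    Tm S Γ C :=
  app (lam Δ b) e

/-- The tuple of the variables of a source context. -/
def vars {Δ : TCtx} : (Γ : SCtx) → SRen Γ Δ → Tm S Δ (tup Γ.emb)
  | .nil, _ => unit
  | Γ ▹ _, v => pair (vars Γ (SRen.precomp (Ren.id Γ).wk v)) (var (v .zero))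

/-- `0_G` -/
def zero {Δ : TCtx} : (A : STy) → Tm S Δ A.emb
  | .real => cst 0
  | .prod A B => pair (zero A) (zero B)
  | .arr _ => lit (fun _ => cst 0)

/-- the sum of ground types -/
def add {Δ : TCtx} : (A : STy) → Tm S Δ A.emb → Tm S Δ A.emb → Tm S Δ A.emb
  | .real, a, b => op2 S.add a b
  | .prod A B, a, b => pair (add A (fst a) (fst b)) (add B (snd a) (snd b))
  | .arr _, a, b => map2 (op2 S.add v1 v0) a b

/-- multiplication of an element of a ground type by a scalar -/
def smul {Δ : TCtx} : (A : STy) → Tm S Δ .real → Tm S Δ A.emb → Tm S Δ A.emb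
  | .real, r, b => op2 S.mul r b
  | .prod A B, r, b => pair (smul A r (fst b)) (smul B r (snd b))
  | .arr _, r, b => map2 (op2 S.mul r.wk₂ v0) b b

/-- `0_Γ` -/
def zeroC {Δ : TCtx} : (Γ : SCtx) → Tm S Δ (tup Γ.emb)
  | .nil => unit
  | Γ ▹ A => pair (zeroC Γ) (zero A)

/-- the sum of ground contexts -/
def addC {Δ : TCtx} : (Γ : SCtx) → Tm S Δ (tup Γ.emb) → Tm S Δ (tup Γ.emb) → Tm S Δ (tup Γ.emb)
  | .nil, _, _ => unit
  | Γ ▹ A, a, b => pair (addC Γ (fst a) (fst b)) (add A (snd a) (snd b))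

def smulC {Δ : TCtx} : (Γ : SCtx) → Tm S Δ .real → Tm S Δ (tup Γ.emb) → Tm S Δ (tup Γ.emb)
  | .nil, _, _ => unit
  | Γ ▹ A, r, b => pair (smulC Γ r (fst b)) (smul A r (snd b))

/-- `[i] e = (0, …, 0, e, 0, …, 0)` with `e` at position `i` -/
def hot {Δ : TCtx} {A : STy} : {Γ : SCtx} → Var Γ A → Tm S Δ A.emb → Tm S Δ (tup Γ.emb)
  | Γ ▹ _, .zero, e => pair (zeroC Γ) e
  | _ ▹ B, .succ i, e => pair (hot i e) (zero B)

/-- Pad a tuple over `Γ` by zeros for the types of `Θ`. -/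
def padZero {Δ : TCtx} {Γ : SCtx} : (Θ : SCtx) → Tm S Δ (tup Γ.emb) →
    Tm S Δ (tup (SCtx.emb (Γ.append Θ)))
  | .nil, t => t
  | Θ ▹ A, t => pair (padZero Θ t) (zero A)

/-- The identity continuation `Id_Γ = fun (y₁, …, yₙ) -> (y₁, …, yₙ)`. -/
def idCont {Δ : TCtx} (Γ : SCtx) : Tm S Δ (.fn (tup Γ.emb) (tup Γ.emb)) :=
  lam Γ.emb (vars Γ ((SRen.id Γ).andThen (Ren.inr Γ.emb)))

end Tm

namespace Src

variable {S : Signature.{u}}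

/-- The source language is a fragment of the target language. -/
def toTm {Γ : SCtx} {A : STy} : Src S Γ A → {Δ : TCtx} → SRen Γ Δ → Tm S Δ A.emb
  | var i, _, v => .var (v i)
  | cst c, _, _ => .cst c
  | let_ e₁ e₂, _, v => .let_ (e₁.toTm v) (e₂.toTm v.lift)
  | pair e₁ e₂, _, v => .pair (e₁.toTm v) (e₂.toTm v)
  | fst e, _, v => .fst (e.toTm v)
  | snd e, _, v => .snd (e.toTm v)
  | op1 f e, _, v => .op1 f (e.toTm v)
  | op2 g e₁ e₂, _, v => .op2 g (e₁.toTm v) (e₂.toTm v)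
  | map2 e₁ e₂ e₃, _, v => .map2 (e₁.toTm v.lift.lift) (e₂.toTm v) (e₃.toTm v)
  | reduce e₁ e₂ e₃, Δ, v => .reduce (e₁.toTm (SRen.empty Δ).lift.lift) (e₂.toTm v) (e₃.toTm v)

end Src

/-! ### Reverse derivatives of `map2` and `reduce` -/

namespace Tm

variable {S : Signature.{u}}

/-- `g` is the gradient `∇_{Γ,x,y} e₁` with `a, b` for `x, y`; the result is
`let G = map2 * Z (map2 (a,b.∇_Γ e₁) A B) in reduce + 0 G`. -/
def map2BackΓ {Δ : TCtx} {n : ℕ} (Γ : SCtx)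
    (g : Tm S (Δ ▹ .real ▹ .real) (tup (SCtx.emb (Γ ▹ .real ▹ .real))))
    (A B Z : Tm S Δ (.arr .real n)) : Tm S Δ (tup Γ.emb) :=
  let_ (map2 (B := tup Γ.emb) (smulC Γ v1 v0) Z (map2 (fst (fst g)) A B))
    (reduce (addC Γ v1 v0) (zeroC Γ) v0)

/-- `map2 * (map2 (a,b.∇_{x} e₁) A B) Z` -/
def map2Back₁ {Δ : TCtx} {n : ℕ} (Γ : SCtx)
    (g : Tm S (Δ ▹ .real ▹ .real) (tup (SCtx.emb (Γ ▹ .real ▹ .real))))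
    (A B Z : Tm S Δ (.arr .real n)) : Tm S Δ (.arr .real n) :=
  map2 (A := .real) (B := .real) (op2 S.mul v1 v0) (map2 (snd (fst g)) A B) Z

/-- `map2 * (map2 (a,b.∇_{y} e₁) A B) Z` -/
def map2Back₂ {Δ : TCtx} {n : ℕ} (Γ : SCtx)
    (g : Tm S (Δ ▹ .real ▹ .real) (tup (SCtx.emb (Γ ▹ .real ▹ .real))))
    (A B Z : Tm S Δ (.arr .real n)) : Tm S Δ (.arr .real n) :=
  map2 (A := .real) (B := .real) (op2 S.mul v1 v0) (map2 (snd g) A B) Z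

/-- The pair `(A₂, A₃)` of arrays used by the reverse derivative of `reduce (x,y.e₁) y₁ A`; `g` is
the gradient `∇_{x,y} e₁` with `a, b` for `x, y`:
`A₀ = shift1R (scanl (x,y.e₁) y₁ A)`, `A₁ = shift1L (map2 (a,b.∇_{x} e₁) A₀ A)`,
`A₂ = map2 (a,b.∇_{y} e₁) A₀ A`, `A₃ = scanr * 1 A₁`.
For arrays of size `0` both are the empty array. -/
def reduceTape {Δ : TCtx} : {n : ℕ} → (e₁ : Tm S (Δ ▹ .real ▹ .real) .real) →
    (g : Tm S (Δ ▹ .real ▹ .real) (tup (SCtx.emb (.nil ▹ .real ▹ .real)))) →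
    (y₁ : Tm S Δ .real) → (A : Tm S Δ (.arr .real n)) →
    Tm S Δ (.prod (.arr .real n) (.arr .real n))
  | 0, _, _, _, _ => pair (lit fun i => i.elim0) (lit fun i => i.elim0)
  | n + 1, e₁, g, y₁, A =>
    let_ (shift1R (n := n + 2) (scanl e₁ y₁ A)) <|
    let_ (A := .arr .real n) (shift1L (n := n + 1)
      (map2 (snd (fst (g.rename (Ren.id Δ).wk.lift.lift))) v0 A.wk)) <|
    let_ (map2 (snd (g.rename (Ren.id Δ).wk.wk.lift.lift)) v1 A.wk₂) <|
    let_ (scanr (op2 S.mul v1 v0) (cst 1) v1) <|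
    pair v1 v0

/-- `map2 (x,y. x * y * z) A₂ A₃` -/
def reduceBack {Δ : TCtx} {n : ℕ} (p : Tm S Δ (.prod (.arr .real n) (.arr .real n)))
    (z : Tm S Δ .real) : Tm S Δ (.arr .real n) :=
  map2 (A := .real) (B := .real) (op2 S.mul (op2 S.mul v1 v0) z.wk₂) (fst p) (snd p)

/-- The continuation `fun (x₁, …, xₙ, z) -> Y(args)`. -/
def backFun {Δ : TCtx} {ρ R : Ty} (Γ : SCtx) (A : STy) (Y : Var Δ (.fn R ρ))
    (args : Tm S (Δ.append Γ.emb ▹ A.emb) R) : Tm S Δ (.fn (tup (SCtx.emb (Γ ▹ A))) ρ) :=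
  lam (SCtx.emb (Γ ▹ A)) (app (var (.succ (Ren.inl Γ.emb Y))) args)

/-- The variables `x₁, …, xₙ` bound by `backFun`, as a tuple. -/
def backVars {Δ : TCtx} (Γ : SCtx) (A : Ty) : Tm S (Δ.append Γ.emb ▹ A) (tup Γ.emb) :=
  vars Γ ((SRen.id Γ).andThen (Ren.inr Γ.emb).wk)

end Tm

namespace Tm

variable {S : Signature.{u}}

/-- From a transformed term `t` with continuation variable `Y`, the gradient
`let Y = Id_Γ in (π₂ t)(0_Γ, 1)`. -/
def runGrad {Δ : TCtx} (Γ : SCtx) (t : Tm S (Δ ▹ .fn (tup Γ.emb) (tup Γ.emb))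
    (.prod .real (.fn (tup (SCtx.emb (Γ ▹ .real))) (tup Γ.emb)))) : Tm S Δ (tup Γ.emb) :=
  let_ (idCont Γ) (app (snd t) (pair (zeroC Γ) (cst 1)))

end Tm

/-- Weakening by the variables bound by `backFun`. -/
def Ren.back {Δ : TCtx} (Γ : SCtx) (A : Ty) : Ren Δ (Δ.append Γ.emb ▹ A) := (Ren.inl Γ.emb).wk

/-- The three variables bound by `letPair`. -/
def Ren.wk₃ {Δ : TCtx} {A B C : Ty} : Ren Δ (Δ ▹ A ▹ B ▹ C) := (Ren.id Δ).wk.wk.wk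

namespace Src

variable {S : Signature.{u}}

open Tm (v0 v1 v4 letPair runGrad map2BackΓ map2Back₁ map2Back₂ reduceTape reduceBack
  backFun backVars zero zeroC add addC hot)

/-- The direct reverse-mode transformation from source to target terms. A term in context `Γ` is
transformed relative to an extension `Γ'` of that context (the variables of `Γ` sit in `Γ'` by
`s`), a continuation variable `Y : Γ' → ρ`, and target variables `v` that hold the values of the
variables of `Γ'`. The result has type `A × (Γ' × A → ρ)`. -/
def direct {Γ : SCtx} {A : STy} : Src S Γ A → {Γ' : SCtx} → {Δ : TCtx} → {ρ : Ty} → Ren Γ Γ' →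
    SRen Γ' Δ → Var Δ (.fn (tup Γ'.emb) ρ) →
    Tm S Δ (.prod A.emb (.fn (tup (SCtx.emb (Γ' ▹ A))) ρ))
  | var (A := A) i, Γ', _, _, s, v, Y =>
    .pair (.var (v (s i))) (backFun Γ' A Y (addC Γ' (backVars Γ' _) (hot (s i) v0)))
  | cst c, Γ', _, _, _, _, Y =>
    .pair (.cst c) (backFun Γ' .real Y (backVars Γ' _))
  | let_ (A := A) (B := B) e₁ e₂, Γ', _, _, s, v, Y =>
    letPair (e₁.direct s v Y) <|
    letPair (e₂.direct (Γ' := Γ' ▹ A) s.lift ((v.andThen Ren.wk₃).cons (.succ .zero)) .zero) <|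
    .pair v1 (backFun Γ' B .zero (.pair (.pair (backVars Γ' _) (zero A)) v0))
  | pair (A := A) (B := B) e₁ e₂, Γ', _, _, s, v, Y =>
    letPair (e₁.direct s v Y) <|
    letPair (e₂.direct (Γ' := Γ' ▹ A) s.wk ((v.andThen Ren.wk₃).cons (.succ .zero)) .zero) <|
    .pair (.pair v4 v1)
      (backFun Γ' (.prod A B) .zero (.pair (.pair (backVars Γ' _) (.fst v0)) (.snd v0)))
  | fst (A := A) (B := B) e, Γ', _, _, s, v, Y =>
    letPair (e.direct s v Y) <|
    .pair (.fst v1) (backFun Γ' A .zero (.pair (backVars Γ' _) (.pair v0 (zero B))))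
  | snd (A := A) (B := B) e, Γ', _, _, s, v, Y =>
    letPair (e.direct s v Y) <|
    .pair (.snd v1) (backFun Γ' B .zero (.pair (backVars Γ' _) (.pair (zero A) v0)))
  | op1 f e, Γ', Δ, _, s, v, Y =>
    letPair (e.direct s v Y) <|
    .pair (.op1 f v1) (backFun Γ' .real .zero (.pair (backVars Γ' _)
      (.op2 S.mul (.op1 (S.d f) (v1.rename (Ren.back Γ' _))) v0)))
  | op2 g e₁ e₂, Γ', _, _, s, v, Y =>
    letPair (e₁.direct s v Y) <|
    letPair (e₂.direct (Γ' := Γ' ▹ .real) s.wk ((v.andThen Ren.wk₃).cons (.succ .zero)) .zero) <|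
    .pair (.op2 g v4 v1) (backFun Γ' .real .zero (.pair (.pair (backVars Γ' _)
      (.op2 S.mul (.op2 (S.d₁ g) (v4.rename (Ren.back Γ' _)) (v1.rename (Ren.back Γ' _))) v0))
      (.op2 S.mul (.op2 (S.d₂ g) (v4.rename (Ren.back Γ' _)) (v1.rename (Ren.back Γ' _))) v0)))
  | map2 (n := n) e₁ e₂ e₃, Γ', _, _, s, v, Y =>
    letPair (e₂.direct s v Y) <|
    letPair (e₃.direct (Γ' := Γ' ▹ .arr n) s.wk ((v.andThen Ren.wk₃).cons (.succ .zero)) .zero) <|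
    let w := (v.andThen Ren.wk₃).andThen Ren.wk₃
    let g := runGrad (Γ' ▹ .real ▹ .real) (e₁.direct (Γ' := Γ' ▹ .real ▹ .real) s.lift.lift
      (w.andThen (Ren.back Γ' _)).lift.lift.wk .zero)
    .pair (.map2 (e₁.toTm (w.precomp s).lift.lift) v4 v1) (backFun Γ' (.arr n) .zero
      (.pair (.pair
        (addC Γ' (backVars Γ' _)
          (map2BackΓ Γ' g (v4.rename (Ren.back Γ' _)) (v1.rename (Ren.back Γ' _)) v0))
        (map2Back₁ Γ' g (v4.rename (Ren.back Γ' _)) (v1.rename (Ren.back Γ' _)) v0))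
        (map2Back₂ Γ' g (v4.rename (Ren.back Γ' _)) (v1.rename (Ren.back Γ' _)) v0)))
  | reduce (n := n) e₁ e₂ e₃, Γ', _, _, s, v, Y =>
    letPair (e₂.direct s v Y) <|
    letPair (e₃.direct (Γ' := Γ' ▹ .real) s.wk ((v.andThen Ren.wk₃).cons (.succ .zero)) .zero) <|
    .let_ (reduceTape (e₁.toTm (SRen.empty _).lift.lift)
      (runGrad (.nil ▹ .real ▹ .real) (e₁.direct (Ren.id _) (SRen.empty _).lift.lift.wk .zero))
      v4 v1) <|
    .pair (.reduce (e₁.toTm (SRen.empty _).lift.lift) v4.wk v1.wk)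
      (backFun Γ' .real (.succ .zero) (.pair (.pair (backVars Γ' _) (zero .real))
        (reduceBack (n := n) (v0.rename (Ren.back Γ' _)) v0)))

/-- `∇_Γ e`, with target variables `v` for the variables of `Γ`. -/
def grad {Γ : SCtx} (e : Src S Γ .real) {Δ : TCtx} (v : SRen Γ Δ) : Tm S Δ (tup Γ.emb) :=
  runGrad Γ (e.direct (Ren.id Γ) v.wk .zero)

end Src

/-! ### Unary normal forms of source terms -/

/-- The primitives of Source UNF. Except for `pair` and `proj`, a primitive returns its context
together with one new value. -/
inductive Prim (S : Signature.{u}) : SCtx → SCtx → Type u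
  | var {Γ : SCtx} {A : STy} : Var Γ A → Prim S Γ (Γ ▹ A)
  | cst {Γ : SCtx} : ℝ → Prim S Γ (Γ ▹ .real)
  | op1 {Γ : SCtx} : S.Op1 → Prim S (Γ ▹ .real) (Γ ▹ .real ▹ .real)
  | op2 {Γ : SCtx} : S.Op2 → Prim S (Γ ▹ .real ▹ .real) (Γ ▹ .real ▹ .real ▹ .real)
  | fst {Γ : SCtx} {A B : STy} : Prim S (Γ ▹ .prod A B) (Γ ▹ .prod A B ▹ A)
  | snd {Γ : SCtx} {A B : STy} : Prim S (Γ ▹ .prod A B) (Γ ▹ .prod A B ▹ B)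
  | pair {Γ : SCtx} {A B : STy} : Prim S (Γ ▹ A ▹ B) (Γ ▹ .prod A B)
  | map2 {Γ : SCtx} {n : ℕ} : Src S (Γ ▹ .real ▹ .real) .real →
      Prim S (Γ ▹ .arr n ▹ .arr n) (Γ ▹ .arr n ▹ .arr n ▹ .arr n)
  | reduce {Γ : SCtx} {n : ℕ} : Src S (.nil ▹ .real ▹ .real) .real → Src S Γ .real →
      Prim S (Γ ▹ .arr n) (Γ ▹ .arr n ▹ .real)
  | proj {Γ : SCtx} (Θ : SCtx) {A : STy} : Prim S (Γ.append Θ ▹ A) (Γ ▹ A)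

/-- Source UNF: sequential compositions of primitives. -/
inductive UNF (S : Signature.{u}) : SCtx → SCtx → Type u
  | prim {Γ Δ : SCtx} : Prim S Γ Δ → UNF S Γ Δ
  | seq {Γ Δ Θ : SCtx} : UNF S Γ Δ → UNF S Δ Θ → UNF S Γ Θ

infixr:60 " ⨟ " => UNF.seq

/-- The transformation to UNF of `Γ ⊢ e`, with `e` placed in the context `Δ` along `s`. The second
argument of a binary construct is placed in the context that is extended by the value of the first
argument. -/
def Src.unfIn {S : Signature.{u}} {Γ : SCtx} {A : STy} :
    Src S Γ A → {Δ : SCtx} → Ren Γ Δ → UNF S Δ (Δ ▹ A)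
  | .var i, _, s => .prim (.var (s i))
  | .cst c, _, _ => .prim (.cst c)
  | .let_ (A := A) e₁ e₂, _, s => e₁.unfIn s ⨟ e₂.unfIn s.lift ⨟ .prim (.proj (.nil ▹ A))
  | .pair e₁ e₂, _, s => e₁.unfIn s ⨟ e₂.unfIn s.wk ⨟ .prim .pair
  | .fst (A := A) (B := B) e, _, s =>
    e.unfIn s ⨟ .prim .fst ⨟ .prim (.proj (.nil ▹ .prod A B))
  | .snd (A := A) (B := B) e, _, s =>
    e.unfIn s ⨟ .prim .snd ⨟ .prim (.proj (.nil ▹ .prod A B))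
  | .op1 f e, _, s => e.unfIn s ⨟ .prim (.op1 f) ⨟ .prim (.proj (.nil ▹ .real))
  | .op2 g e₁ e₂, _, s =>
    e₁.unfIn s ⨟ e₂.unfIn s.wk ⨟ .prim (.op2 g) ⨟ .prim (.proj (.nil ▹ .real ▹ .real))
  | .map2 (n := n) e₁ e₂ e₃, _, s =>
    e₂.unfIn s ⨟ e₃.unfIn s.wk ⨟ .prim (.map2 (e₁.rename s.lift.lift)) ⨟
      .prim (.proj (.nil ▹ .arr n ▹ .arr n))
  | .reduce (n := n) e₁ e₂ e₃, _, s =>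
    e₃.unfIn s ⨟ .prim (.reduce e₁ (e₂.rename s)) ⨟ .prim (.proj (.nil ▹ .arr n))

/-- The transformation `UNF` from the source language to Source UNF. -/
def Src.unf {S : Signature.{u}} {Γ : SCtx} {A : STy} (e : Src S Γ A) : UNF S Γ (Γ ▹ A) :=
  e.unfIn (Ren.id Γ)

/-! ### Target UNF and reverse mode on unary normal forms -/

/-- Continuation-valued and tuple-valued expressions of Target UNF. -/
inductive TExp (S : Signature.{u}) : TCtx → Ty → Type u
  /-- the continuation variable, last in the context -/
  | cont {Γ : TCtx} {K : Ty} : TExp S (Γ ▹ K) K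
  /-- the transposed Jacobian `J^T p` of a primitive `p : Γ → Δ`: in a context that consists of a
  point of `Γ`, a continuation variable and a tangent vector at `Δ`, a tangent vector at `Γ` -/
  | jac {Γ Δ : SCtx} {K : Ty} (p : Prim S Γ Δ) : TExp S ((Γ.emb ▹ K).append Δ.emb) (tup Γ.emb)
  /-- the composition `e₁ ∘ e₂` of a continuation with a map `Θ → R` -/
  | comp {Γ : TCtx} {R ρ : Ty} (Θ : TCtx) : TExp S Γ (.fn R ρ) → TExp S (Γ.append Θ) R →
      TExp S Γ (.fn (tup Θ) ρ)

/-- Target UNF. -/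
inductive TUNF (S : Signature.{u}) : TCtx → TCtx → Type u
  | prim {Γ Δ : SCtx} {K : Ty} : Prim S Γ Δ → TUNF S (Γ.emb ▹ K) Δ.emb
  | pair {Γ Δ : TCtx} {A : Ty} : TUNF S Γ Δ → TExp S Γ A → TUNF S Γ (Δ ▹ A)
  | seq {Γ Δ Θ : TCtx} : TUNF S Γ Δ → TUNF S Δ Θ → TUNF S Γ Θ

/-- `D_ρ(A₁, …, Aₙ) = A₁, …, Aₙ, (A₁ × ⋯ × Aₙ → ρ)` -/
def revCtx (ρ : Ty) (Γ : SCtx) : TCtx := Γ.emb ▹ .fn (tup Γ.emb) ρ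

/-- Reverse mode `D_ρ` from Source UNF to Target UNF: a primitive `p` is sent to
`⟨p, Y ∘ J^T p⟩`, where `Y` is the continuation variable. -/
def revD {S : Signature.{u}} (ρ : Ty) {Γ Δ : SCtx} :
    UNF S Γ Δ → TUNF S (revCtx ρ Γ) (revCtx ρ Δ)
  | .prim (Δ := Δ) p => .pair (.prim p) (.comp Δ.emb .cont (.jac p))
  | .seq u v => .seq (revD ρ u) (revD ρ v)

/-! ### From Target UNF to the target language -/

namespace Prim

variable {S : Signature.{u}}

open Tm (v0 v1 vars zero add addC hot padZero)

/-- The new value computed by a primitive and the part of its context that it returns, as a tuple;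
`v` are target variables for the input of the primitive. -/
def toTm {Γ Γ' : SCtx} : Prim S Γ Γ' → {Δ : TCtx} → SRen Γ Δ → Tm S Δ (tup Γ'.emb)
  | var i, _, v => .pair (vars _ v) (.var (v i))
  | cst c, _, v => .pair (vars _ v) (.cst c)
  | op1 f, _, v => .pair (vars _ v) (.op1 f (.var (v .zero)))
  | op2 g, _, v => .pair (vars _ v) (.op2 g (.var (v (.succ .zero))) (.var (v .zero)))
  | fst, _, v => .pair (vars _ v) (.fst (.var (v .zero)))
  | snd, _, v => .pair (vars _ v) (.snd (.var (v .zero)))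
  | pair (Γ := Γ), _, v => .pair (vars Γ (v.precomp (Ren.id Γ).wk.wk))
      (.pair (.var (v (.succ .zero))) (.var (v .zero)))
  | map2 (Γ := Γ) e, _, v => .pair (vars _ v)
      (.map2 (e.toTm (v.precomp (Ren.id Γ).wk.wk).lift.lift) (.var (v (.succ .zero)))
        (.var (v .zero)))
  | reduce (Γ := Γ) e₁ e₂, Δ, v => .pair (vars _ v)
      (.reduce (e₁.toTm (SRen.empty Δ).lift.lift) (e₂.toTm (v.precomp (Ren.id Γ).wk))
        (.var (v .zero)))
  | proj (Γ := Γ) Θ, _, v => .pair (vars Γ (v.precomp (Ren.inl Θ).wk)) (.var (v .zero))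

/-- The transposed Jacobian of a primitive as a target term; `v` are target variables for the point
and `y` are target variables for the tangent vector at the output. -/
def jacTm {Γ Γ' : SCtx} : Prim S Γ Γ' → {Δ : TCtx} → SRen Γ Δ → SRen Γ' Δ → Tm S Δ (tup Γ.emb)
  | var (Γ := Γ) i, _, _, y =>
    addC Γ (vars Γ (y.precomp (Ren.id Γ).wk)) (hot i (.var (y .zero)))
  | cst (Γ := Γ) _, _, _, y => vars Γ (y.precomp (Ren.id Γ).wk)
  | op1 (Γ := Γ) f, _, v, y =>
    .pair (vars Γ (y.precomp (Ren.id Γ).wk.wk))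
      (.op2 S.add (.var (y (.succ .zero)))
        (.op2 S.mul (.op1 (S.d f) (.var (v .zero))) (.var (y .zero))))
  | op2 (Γ := Γ) g, _, v, y =>
    .pair (.pair (vars Γ (y.precomp (Ren.id Γ).wk.wk.wk))
      (.op2 S.add (.var (y (.succ (.succ .zero))))
        (.op2 S.mul (.op2 (S.d₁ g) (.var (v (.succ .zero))) (.var (v .zero))) (.var (y .zero)))))
      (.op2 S.add (.var (y (.succ .zero)))
        (.op2 S.mul (.op2 (S.d₂ g) (.var (v (.succ .zero))) (.var (v .zero))) (.var (y .zero))))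
  | fst (Γ := Γ) (A := A) (B := B), _, _, y =>
    .pair (vars Γ (y.precomp (Ren.id Γ).wk.wk))
      (add (.prod A B) (.var (y (.succ .zero))) (.pair (.var (y .zero)) (zero B)))
  | snd (Γ := Γ) (A := A) (B := B), _, _, y =>
    .pair (vars Γ (y.precomp (Ren.id Γ).wk.wk))
      (add (.prod A B) (.var (y (.succ .zero))) (.pair (zero A) (.var (y .zero))))
  | pair (Γ := Γ), _, _, y =>
    .pair (.pair (vars Γ (y.precomp (Ren.id Γ).wk)) (.fst (.var (y .zero))))
      (.snd (.var (y .zero)))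
  | map2 (Γ := Γ) (n := n) e, _, v, y =>
    let g := e.grad (v.precomp (Ren.id Γ).wk.wk).lift.lift
    let A := .var (v (.succ .zero))
    let B := .var (v .zero)
    let Z := .var (y .zero)
    .pair (.pair
      (addC Γ (vars Γ (y.precomp (Ren.id Γ).wk.wk.wk)) (Tm.map2BackΓ Γ g A B Z))
      (add (.arr n) (.var (y (.succ (.succ .zero)))) (Tm.map2Back₁ Γ g A B Z)))
      (add (.arr n) (.var (y (.succ .zero))) (Tm.map2Back₂ Γ g A B Z))
  | reduce (Γ := Γ) (n := n) e₁ e₂, Δ, v, y =>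
    .pair (vars Γ (y.precomp (Ren.id Γ).wk.wk))
      (add (.arr n) (.var (y (.succ .zero)))
        (.let_ (Tm.reduceTape (e₁.toTm (SRen.empty Δ).lift.lift) (e₁.grad (SRen.empty Δ).lift.lift)
            (e₂.toTm (v.precomp (Ren.id Γ).wk)) (.var (v .zero)))
          (Tm.reduceBack v0 (.var (.succ (y .zero))))))
  | proj (Γ := Γ) Θ, _, _, y =>
    .pair (padZero Θ (vars Γ (y.precomp (Ren.id Γ).wk))) (.var (y .zero))

end Prim

/-- Compilation of the expressions of Target UNF to target terms. -/
def TExp.toTm {S : Signature.{u}} {Γ : TCtx} {A : Ty} : TExp S Γ A → Tm S Γ A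
  | .cont => Tm.v0
  | .jac (Γ := Γ) (Δ := Δ) p =>
    p.jacTm ((SRen.id Γ).wk.andThen (Ren.inl Δ.emb)) ((SRen.id Δ).andThen (Ren.inr Δ.emb))
  | .comp Θ e₁ e₂ => .lam Θ (.app (e₁.toTm.rename (Ren.inl Θ)) e₂.toTm)

/-- Compilation of Target UNF to target terms: a term of Target UNF with the output context
`B₁, …, Bₘ` is compiled to a term of type `B₁ × ⋯ × Bₘ`, and sequential composition is a `let`. -/
def TUNF.toTm {S : Signature.{u}} {Γ Δ : TCtx} : TUNF S Γ Δ → Tm S Γ (tup Δ)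
  | .prim (Γ := Γ) p => p.toTm (SRen.id Γ).wk
  | .pair u e => .pair u.toTm e.toTm
  | .seq (Δ := Δ) u v => Tm.letTup Δ u.toTm (v.toTm.rename (Ren.inr Δ))

/-- The transformation `UNF⁻¹` back to the target language: the compiled term, projected to the
last value and the continuation. -/
def TUNF.inv {S : Signature.{u}} {Γ Δ : TCtx} {A K : Ty} (u : TUNF S Γ (Δ ▹ A ▹ K)) :
    Tm S Γ (.prod A K) :=
  Tm.letTup (Δ ▹ A ▹ K) u.toTm (.pair Tm.v1 Tm.v0)

/-! ### Contexts of reals -/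

/-- The context `x₁ : ℝ, …, xₙ : ℝ`. -/
def realCtx : ℕ → SCtx
  | 0 => .nil
  | n + 1 => realCtx n ▹ .real

/-- The environment of `x₁ : ℝ, …, xₙ : ℝ` given by a vector. -/
def env : (n : ℕ) → (Fin n → ℝ) → TCtx.Env (realCtx n).emb
  | 0, _ => PUnit.unit
  | n + 1, x => (env n (fun i => x i.castSucc), x (Fin.last n))

/-- The map `⟨Id, ⟦e⟧⟩ : ℝⁿ → ℝⁿ⁺¹`. -/
def pairIdDen {S : Signature.{u}} {n : ℕ} (e : Src S (realCtx n) .real) (x : Fin n → ℝ) :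
    Fin (n + 1) → ℝ :=
  Fin.snoc (α := fun _ => ℝ) x (e.den (env n x))

/-- The Jacobian matrix of `f` at `x`. -/
def jacobian {m n : ℕ} (f : (Fin n → ℝ) → Fin m → ℝ) (x : Fin n → ℝ) : Matrix (Fin m) (Fin n) ℝ :=
  LinearMap.toMatrix' (fderiv ℝ f x).toLinearMap

/-- The term `π₂ UNF⁻¹(D_ρ(UNF(e)))`, in the context `x₁ : ℝ, …, xₙ : ℝ, Y : ℝⁿ → ρ` and of type
`ℝⁿ × ℝ → ρ`, for `ρ = ℝⁿ`. -/
def backprop {S : Signature.{u}} {n : ℕ} (e : Src S (realCtx n) .real) :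
    Tm S (revCtx (tup (realCtx n).emb) (realCtx n))
      (.fn (tup (realCtx (n + 1)).emb) (tup (realCtx n).emb)) :=
  .snd (TUNF.inv (revD (tup (realCtx n).emb) e.unf))

end

end RevAD

/-! The proof rests on a notion of transposed derivative that composes. Contexts mix reals, products
and arrays, so derivatives are tested along curves: `IsVJP f γ G` says that every curve through `γ`
with velocity `c'` is mapped to a curve with some velocity `d`, and that ⟨G z, c'⟩ = ⟨z, d⟩ for
every cotangent `z`. The chain rule `IsVJP.comp` is then immediate. It composes the transposes in
reverse order, which is exactly what iterating `Y ↦ Y ∘ J^T p` does to the continuation.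

The theorem thus reduces to the primitives: each has a transposed derivative `G` that the term for
`J^T p` computes (`Prim.exists_jacSpec`), and `UNF.exists_revD_spec` carries this along sequential
composition. As `UNF(e)` denotes ⟨Id, ⟦e⟧⟩ (`Src.den_unf`), starting from the identity continuation
leaves the transposed derivative of that map. `IsVJP.eq_jacobian` identifies it with the transposed
Jacobian by testing on coordinate lines.

The substance lies in `map2` and `reduce`, whose transposed Jacobians contain gradients of the
function argument. These come from the direct transformation, so its correctness,
`Src.exists_directSpec`, is proved beforehand by induction on source terms. A gradient is obtained
from it by supplying the identity continuation and the cotangent (0, 1). For a fold of `m`, with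
partial derivatives `p` and `q`, the derivative in entry `i` is `q` at step `i` times the product of
`p` over all later steps (`hasDerivAt_foldArr`). The left scan supplies the points of evaluation and
the right scan the suffix products (`scanrArr_mul`). No cotangent is sent to the initial value of a
`reduce`; this is correct because a two-sided unit is unique, so the initial value does not depend
on the environment (`Src.ReduceOK.den_unit`).

Smoothness comes from the semantics: a source term is also a target term, which denotes a smooth map
of diffeological spaces, and on Euclidean spaces this is ordinary smoothness. -/

namespace RevAD

/-! ### The linear structure of ground types -/

namespace STy

/-- The sum of two values of a ground type. -/
def addV : (A : STy) → A.emb.den → A.emb.den → A.emb.den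
  | .real => @HAdd.hAdd ℝ ℝ ℝ _
  | .prod A B => fun a b => (A.addV a.1 b.1, B.addV a.2 b.2)
  | .arr _ => fun a b i => @HAdd.hAdd ℝ ℝ ℝ _ (a i) (b i)

/-- The zero of a ground type. -/
def zeroV : (A : STy) → A.emb.den
  | .real => (0 : ℝ)
  | .prod A B => (A.zeroV, B.zeroV)
  | .arr _ => fun _ => (0 : ℝ)

/-- Scalar multiplication on a ground type. -/
def smulV : (A : STy) → ℝ → A.emb.den → A.emb.den
  | .real => @HMul.hMul ℝ ℝ ℝ _
  | .prod A B => fun r b => (A.smulV r b.1, B.smulV r b.2)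
  | .arr _ => fun r b i => @HMul.hMul ℝ ℝ ℝ _ r (b i)

/-- The standard inner product on a ground type. -/
def dot : (A : STy) → A.emb.den → A.emb.den → ℝ
  | .real => @HMul.hMul ℝ ℝ ℝ _
  | .prod A B => fun a b => A.dot a.1 b.1 + B.dot a.2 b.2
  | .arr n => @dotProduct (Fin n) ℝ _ _ _

/-- The curve `c` has velocity `c'` at time `0`. -/
def HasVel : (A : STy) → (ℝ → A.emb.den) → A.emb.den → Prop
  | .real => fun c c' => HasDerivAt (F := ℝ) c c' 0
  | .prod A B => fun c c' => A.HasVel (fun t => (c t).1) c'.1 ∧ B.HasVel (fun t => (c t).2) c'.2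
  | .arr n => fun c c' => ∀ i : Fin n, HasDerivAt (F := ℝ) (fun t => c t i) (c' i) 0

theorem dot_addV : (A : STy) → (a b c : A.emb.den) →
    A.dot (A.addV a b) c = A.dot a c + A.dot b c
  | .real => add_mul (R := ℝ)
  | .prod A B => fun a b c =>
    (congrArg₂ (· + ·) (dot_addV A a.1 b.1 c.1) (dot_addV B a.2 b.2 c.2)).trans
      (add_add_add_comm _ _ _ _)
  | .arr n => add_dotProduct (m := Fin n) (α := ℝ)

theorem dot_zeroV : (A : STy) → (c : A.emb.den) → A.dot A.zeroV c = 0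
  | .real => zero_mul (M₀ := ℝ)
  | .prod A B => fun c =>
    (congrArg₂ (· + ·) (dot_zeroV A c.1) (dot_zeroV B c.2)).trans (add_zero _)
  | .arr n => zero_dotProduct (m := Fin n) (α := ℝ)

theorem dot_smulV : (A : STy) → (r : ℝ) → (b c : A.emb.den) →
    A.dot (A.smulV r b) c = r * A.dot b c
  | .real => mul_assoc (G := ℝ)
  | .prod A B => fun r b c =>
    (congrArg₂ (· + ·) (dot_smulV A r b.1 c.1) (dot_smulV B r b.2 c.2)).trans
      (mul_add _ _ _).symm
  | .arr n => smul_dotProduct (m := Fin n) (α := ℝ) (R := ℝ)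

end STy

/-! ### Linear structure of environments, and adjoint pairs between contexts. -/

namespace SCtx

/-- The sum of two environments of a source context. -/
def addV : (Γ : SCtx) → TCtx.Env Γ.emb → TCtx.Env Γ.emb → TCtx.Env Γ.emb
  | .nil => fun _ _ => PUnit.unit
  | Γ ▹ A => fun a b => (addV Γ a.1 b.1, A.addV a.2 b.2)

/-- The zero environment of a source context. -/
def zeroV : (Γ : SCtx) → TCtx.Env Γ.emb
  | .nil => PUnit.unit
  | Γ ▹ A => (zeroV Γ, A.zeroV)

/-- Scalar multiplication on the environments of a source context. -/
def smulV : (Γ : SCtx) → ℝ → TCtx.Env Γ.emb → TCtx.Env Γ.emb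
  | .nil => fun _ _ => PUnit.unit
  | Γ ▹ A => fun r b => (smulV Γ r b.1, A.smulV r b.2)

/-- The standard inner product on the environments of a source context. -/
def dot : (Γ : SCtx) → TCtx.Env Γ.emb → TCtx.Env Γ.emb → ℝ
  | .nil => fun _ _ => 0
  | Γ ▹ A => fun a b => dot Γ a.1 b.1 + A.dot a.2 b.2

/-- The curve `c` of environments has velocity `c'` at time `0`. -/
def HasVel : (Γ : SCtx) → (ℝ → TCtx.Env Γ.emb) → TCtx.Env Γ.emb → Prop
  | .nil => fun _ _ => True
  | Γ ▹ A => fun c c' => HasVel Γ (fun t => (c t).1) c'.1 ∧ A.HasVel (fun t => (c t).2) c'.2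

/-- The environment that holds `a` at the variable `i` and zeros elsewhere. -/
def hotV {A : STy} : {Γ : SCtx} → Var Γ A → A.emb.den → TCtx.Env Γ.emb
  | Γ ▹ _, .zero => fun a => (zeroV Γ, a)
  | _ ▹ B, .succ i => fun a => (hotV i a, B.zeroV)

/-- Extension of an environment by zeros. -/
def padV {Γ : SCtx} : (Θ : SCtx) → TCtx.Env Γ.emb → TCtx.Env (SCtx.emb (Γ.append Θ))
  | .nil => fun γ => γ
  | Θ ▹ A => fun γ => (padV Θ γ, A.zeroV)

/-- Restriction of an environment along an extension of contexts. -/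
def dropV {Γ : SCtx} : (Θ : SCtx) → TCtx.Env (SCtx.emb (Γ.append Θ)) → TCtx.Env Γ.emb
  | .nil => fun γ => γ
  | Θ ▹ _ => fun γ => dropV Θ γ.1

/-- The environment of `Γ` selected by a renaming into `Δ`. -/
def pull : {Γ Δ : SCtx} → Ren Γ Δ → TCtx.Env Δ.emb → TCtx.Env Γ.emb
  | .nil, _, _ => fun _ => PUnit.unit
  | _ ▹ _, _, s => fun δ => (pull (fun _ i => s (.succ i)) δ, (s .zero).get δ)

theorem dot_addV : (Γ : SCtx) → (a b c : TCtx.Env Γ.emb) →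
    dot Γ (addV Γ a b) c = dot Γ a c + dot Γ b c
  | .nil => fun _ _ _ => (add_zero (0 : ℝ)).symm
  | Γ ▹ A => fun a b c =>
    (congrArg₂ (· + ·) (dot_addV Γ a.1 b.1 c.1) (A.dot_addV a.2 b.2 c.2)).trans
      (add_add_add_comm _ _ _ _)

theorem dot_zeroV : (Γ : SCtx) → (c : TCtx.Env Γ.emb) → dot Γ (zeroV Γ) c = 0
  | .nil => fun _ => rfl
  | Γ ▹ A => fun c =>
    (congrArg₂ (· + ·) (dot_zeroV Γ c.1) (A.dot_zeroV c.2)).trans (add_zero _)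

theorem dot_smulV : (Γ : SCtx) → (r : ℝ) → (b c : TCtx.Env Γ.emb) →
    dot Γ (smulV Γ r b) c = r * dot Γ b c
  | .nil => fun r _ _ => (mul_zero r).symm
  | Γ ▹ A => fun r b c =>
    (congrArg₂ (· + ·) (dot_smulV Γ r b.1 c.1) (A.dot_smulV r b.2 c.2)).trans (mul_add _ _ _).symm

/-- Insertion at `i` is the transpose of reading the variable `i`; this is the adjunction behind the
derivative of a variable. -/
theorem dot_hotV {A : STy} : {Γ : SCtx} → (i : Var Γ A) → (a : A.emb.den) → (c : TCtx.Env Γ.emb) →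
    dot Γ (hotV i a) c = A.dot a (i.get c)
  | Γ ▹ _, .zero => fun a c =>
    (congrArg (· + A.dot a c.2) (dot_zeroV Γ c.1)).trans (zero_add _)
  | Γ ▹ B, .succ i => fun a c =>
    (congrArg₂ (· + ·) (dot_hotV i a c.1) (B.dot_zeroV c.2)).trans (add_zero _)

/-- Padding by zeros is the transpose of forgetting variables, which gives the derivative of `proj`.
-/
theorem dot_padV {Γ : SCtx} : (Θ : SCtx) → (a : TCtx.Env Γ.emb) →
    (c : TCtx.Env (SCtx.emb (Γ.append Θ))) → dot (Γ.append Θ) (padV Θ a) c = dot Γ a (dropV Θ c)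
  | .nil => fun _ _ => rfl
  | Θ ▹ A => fun a c =>
    (congrArg₂ (· + ·) (dot_padV Θ a c.1) (A.dot_zeroV c.2)).trans (add_zero _)

theorem hasVel_get {A : STy} : {Γ : SCtx} → (i : Var Γ A) → {c : ℝ → TCtx.Env Γ.emb} →
    {c' : TCtx.Env Γ.emb} → HasVel Γ c c' → A.HasVel (fun t => i.get (c t)) (i.get c')
  | _ ▹ _, .zero => fun h => h.2
  | _ ▹ _, .succ i => fun h => hasVel_get i h.1

theorem hasVel_dropV {Γ : SCtx} : (Θ : SCtx) → {c : ℝ → TCtx.Env (SCtx.emb (Γ.append Θ))} →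
    {c' : TCtx.Env (SCtx.emb (Γ.append Θ))} → HasVel (Γ.append Θ) c c' →
    HasVel Γ (fun t => dropV Θ (c t)) (dropV Θ c')
  | .nil => fun h => h
  | Θ ▹ _ => fun h => hasVel_dropV Θ h.1

theorem get_pull {A : STy} : {Γ Δ : SCtx} → (s : Ren Γ Δ) → (i : Var Γ A) →
    (δ : TCtx.Env Δ.emb) → i.get (pull s δ) = (s i).get δ
  | _ ▹ _, _, _, .zero => fun _ => rfl
  | _ ▹ _, _, s, .succ i => fun δ => get_pull (fun _ i => s (.succ i)) i δ

/-- Variables separate environments. The equations for `pull` below follow from this without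
recursion on contexts. -/
theorem env_ext : {Γ : SCtx} → {γ γ' : TCtx.Env Γ.emb} →
    (∀ (A : STy) (i : Var Γ A), i.get γ = i.get γ') → γ = γ'
  | .nil => fun _ => rfl
  | _ ▹ A => fun h => Prod.ext (env_ext fun B i => h B (.succ i)) (h A .zero)

theorem pull_congr {Γ Δ Δ' : SCtx} {s : Ren Γ Δ} {s' : Ren Γ Δ'} {δ : TCtx.Env Δ.emb}
    {δ' : TCtx.Env Δ'.emb} (h : ∀ ⦃A : STy⦄ (i : Var Γ A), (s i).get δ = (s' i).get δ') :
    pull s δ = pull s' δ' :=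
  env_ext fun _ i => (get_pull s i δ).trans ((h i).trans (get_pull s' i δ').symm)

theorem pull_wk {Γ Δ : SCtx} {B : STy} (s : Ren Γ Δ) (δ : TCtx.Env Δ.emb) (b : B.emb.den) :
    pull (s.wk (B := B)) (δ, b) = pull s δ :=
  pull_congr fun _ _ => rfl

theorem pull_lift {Γ Δ : SCtx} {A : STy} (s : Ren Γ Δ) (δ : TCtx.Env Δ.emb) (a : A.emb.den) :
    pull (s.lift (B := A)) (δ, a) = (pull s δ, a) :=
  Prod.ext (pull_congr fun _ _ => rfl) rfl

theorem pull_lift₂ {Γ Δ : SCtx} {A B : STy} (s : Ren Γ Δ) (δ : TCtx.Env Δ.emb) (a : A.emb.den)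
    (b : B.emb.den) :
    pull (s.lift (B := A)).lift (Δ := Δ ▹ A ▹ B) ((δ, a), b) = ((pull s δ, a), b) :=
  (pull_lift (s.lift (B := A)) (δ, a) b).trans (congrArg (·, b) (pull_lift s δ a))

theorem pull_id {Γ : SCtx} (δ : TCtx.Env Γ.emb) : pull (Ren.id Γ) δ = δ :=
  env_ext fun _ i => get_pull (Ren.id Γ) i δ

end SCtx

/-! ### Renamings and environments -/

/-- The environment `γ` is the one selected from `δ` by the renaming `r`. -/
def Ren.Sel {Γ Δ : TCtx} (r : Ren Γ Δ) (γ : TCtx.Env Γ) (δ : TCtx.Env Δ) : Prop :=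
  ∀ ⦃A : Ty⦄ (i : Var Γ A), (r i).val δ = i.val γ

/-- The environment `γ` is the one selected from `δ` by the assignment `v`. -/
def SRen.Sel {Γ : SCtx} {Δ : TCtx} (v : SRen Γ Δ) (γ : TCtx.Env Γ.emb) (δ : TCtx.Env Δ) : Prop :=
  ∀ ⦃A : STy⦄ (i : Var Γ A), (v i).val δ = i.get γ

namespace Ren

variable {Γ Δ : TCtx} {B : Ty}

theorem sel_id (γ : TCtx.Env Γ) : (Ren.id Γ).Sel γ γ := fun _ _ => rfl

theorem Sel.wk {r : Ren Γ Δ} {γ : TCtx.Env Γ} {δ : TCtx.Env Δ} (h : r.Sel γ δ) (b : B.den) :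
    (r.wk (B := B)).Sel γ (δ, b) := fun _ i => h i

theorem Sel.lift {r : Ren Γ Δ} {γ : TCtx.Env Γ} {δ : TCtx.Env Δ} (h : r.Sel γ δ) (b : B.den) :
    (r.lift (B := B)).Sel (γ, b) (δ, b) := fun _ i =>
  match i with
  | .zero => rfl
  | .succ j => h j

theorem Sel.liftN {r : Ren Γ Δ} {γ : TCtx.Env Γ} {δ : TCtx.Env Δ} (h : r.Sel γ δ) :
    (Θ : TCtx) → (θ : TCtx.Env Θ) → (r.liftN Θ).Sel (appendEnv Θ γ θ) (appendEnv Θ δ θ)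
  | .nil => fun _ => h
  | Θ ▹ _ => fun θ => (h.liftN Θ θ.1).lift θ.2

theorem sel_inl (γ : TCtx.Env Γ) :
    (Θ : TCtx) → (θ : TCtx.Env Θ) → (Ren.inl (Γ := Γ) Θ).Sel γ (appendEnv Θ γ θ)
  | .nil => fun _ => sel_id γ
  | Θ ▹ _ => fun θ => (sel_inl γ Θ θ.1).wk θ.2

theorem sel_inr (γ : TCtx.Env Γ) :
    (Θ : TCtx) → (θ : TCtx.Env Θ) → (Ren.inr (Γ := Γ) Θ).Sel θ (appendEnv Θ γ θ)
  | .nil => fun _ _ i => nomatch i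
  | Θ ▹ _ => fun θ => (sel_inr γ Θ θ.1).lift θ.2

end Ren

namespace SRen

variable {Γ : SCtx} {Δ : TCtx}

theorem sel_id : {Γ : SCtx} → (γ : TCtx.Env Γ.emb) → (SRen.id Γ).Sel γ γ
  | .nil => fun _ _ i => nomatch i
  | Γ ▹ _ => fun γ _ i =>
    match i with
    | .zero => rfl
    | .succ j => sel_id (Γ := Γ) γ.1 j

theorem sel_empty (δ : TCtx.Env Δ) : (SRen.empty Δ).Sel PUnit.unit δ := fun _ i => nomatch i

theorem Sel.andThen {v : SRen Γ Δ} {γ : TCtx.Env Γ.emb} {δ : TCtx.Env Δ} (h : v.Sel γ δ)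
    {Θ : TCtx} {r : Ren Δ Θ} {θ : TCtx.Env Θ} (h' : r.Sel δ θ) : (v.andThen r).Sel γ θ :=
  fun _ i => (h' (v i)).trans (h i)

theorem Sel.precomp {v : SRen Γ Δ} {γ : TCtx.Env Γ.emb} {δ : TCtx.Env Δ} (h : v.Sel γ δ)
    {Γ' : SCtx} (s : Ren Γ' Γ) : (v.precomp s).Sel (SCtx.pull s γ) δ :=
  fun _ i => (h (s i)).trans (SCtx.get_pull s i γ).symm

theorem Sel.wk {v : SRen Γ Δ} {γ : TCtx.Env Γ.emb} {δ : TCtx.Env Δ} (h : v.Sel γ δ)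
    {B : Ty} (b : B.den) : (v.wk (B := B)).Sel γ (δ, b) := fun _ i => h i

theorem Sel.lift {v : SRen Γ Δ} {γ : TCtx.Env Γ.emb} {δ : TCtx.Env Δ} (h : v.Sel γ δ)
    {B : STy} (b : B.emb.den) : (v.lift (B := B)).Sel (γ, b) (δ, b) := fun _ i =>
  match i with
  | .zero => rfl
  | .succ j => h j

theorem Sel.cons {v : SRen Γ Δ} {γ : TCtx.Env Γ.emb} {δ : TCtx.Env Δ} (h : v.Sel γ δ)
    {B : STy} {k : Var Δ B.emb} {b : B.emb.den} (hk : k.val δ = b) :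
    (v.cons k).Sel (γ, b) δ := fun _ i =>
  match i with
  | .zero => hk
  | .succ j => h j

/-- Restriction to the part of the context below an extension. -/
theorem Sel.dropV {δ : TCtx.Env Δ} : (Θ : SCtx) → {A : STy} → {v : SRen (Γ.append Θ ▹ A) Δ} →
    {γ : TCtx.Env (SCtx.emb (Γ.append Θ ▹ A))} → v.Sel γ δ →
    (v.precomp (Ren.inl Θ).wk).Sel (SCtx.dropV Θ γ.1) δ
  | .nil, _, _, _ => fun h _ i => h (.succ i)
  -- In the recursive call the last variable of `Θ` takes the place of the top variable that has
  -- just been discarded.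
  | Θ ▹ B, _, v, γ => fun h =>
    dropV Θ (v := v.precomp (Ren.id (Γ.append Θ ▹ B)).wk) (γ := γ.1) fun _ i => h (.succ i)

end SRen

/-! ### Renaming of target terms and values of the auxiliary terms. -/

namespace Tm

variable {S : Signature.{u}}

/-- The two environments are only required to be related by `Sel`. This relation is stable under
`lift` and `liftN`, so the induction passes under every binder. -/
theorem den_rename {Γ : TCtx} {A : Ty} (t : Tm S Γ A) : ∀ {Δ : TCtx} {r : Ren Γ Δ}
    {γ : TCtx.Env Γ} {δ : TCtx.Env Δ}, r.Sel γ δ → (t.rename r).den δ = t.den γ := by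
  induction t with
  | var i => exact fun h => h i
  | cst c => exact fun _ => rfl
  | let_ e₁ e₂ ih₁ ih₂ =>
    intro Δ r γ δ h
    change (e₂.rename r.lift).den (δ, (e₁.rename r).den δ) = e₂.den (γ, e₁.den γ)
    rw [ih₁ h]; exact ih₂ (h.lift _)
  | unit => exact fun _ => rfl
  | pair e₁ e₂ ih₁ ih₂ => exact fun h => Prod.ext (ih₁ h) (ih₂ h)
  | fst e ih => exact fun h => congrArg Prod.fst (ih h)
  | snd e ih => exact fun h => congrArg Prod.snd (ih h)
  | op1 f e ih => exact fun h => congrArg (S.den1 f) (ih h)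
  | op2 g e₁ e₂ ih₁ ih₂ => exact fun h => congrArg₂ (S.den2 g) (ih₁ h) (ih₂ h)
  | map2 e₁ e₂ e₃ ih₁ ih₂ ih₃ =>
    intro Δ r γ δ h
    funext i
    change (e₁.rename r.lift.lift).den ((δ, (e₂.rename r).den δ i), (e₃.rename r).den δ i) =
      e₁.den ((γ, e₂.den γ i), e₃.den γ i)
    rw [ih₂ h, ih₃ h]; exact ih₁ ((h.lift _).lift _)
  | reduce e₁ e₂ e₃ ih₁ ih₂ ih₃ =>
    intro Δ r γ δ h
    change foldArr (fun a b => (e₁.rename r.lift.lift).den ((δ, a), b)) ((e₂.rename r).den δ) _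
      ((e₃.rename r).den δ) = foldArr (fun a b => e₁.den ((γ, a), b)) (e₂.den γ) _ (e₃.den γ)
    rw [ih₂ h, ih₃ h]
    exact congrArg (fun m => foldArr m _ _ _) (funext₂ fun a b => ih₁ ((h.lift a).lift b))
  | lam Θ e ih => exact fun h => SmoothMap.ext (funext fun θ => ih (h.liftN Θ θ))
  | app e₁ e₂ ih₁ ih₂ => exact fun h => congrArg₂ SmoothMap.toFun (ih₁ h) (ih₂ h)
  | lit e ih => exact fun h => funext fun i => ih i h
  | scanl e₁ e₂ e₃ ih₁ ih₂ ih₃ =>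
    intro Δ r γ δ h
    change scanlArr (fun a b => (e₁.rename r.lift.lift).den ((δ, a), b)) ((e₂.rename r).den δ) _
      ((e₃.rename r).den δ) = scanlArr (fun a b => e₁.den ((γ, a), b)) (e₂.den γ) _ (e₃.den γ)
    rw [ih₂ h, ih₃ h]
    exact congrArg (fun m => scanlArr m _ _ _) (funext₂ fun a b => ih₁ ((h.lift a).lift b))
  | scanr e₁ e₂ e₃ ih₁ ih₂ ih₃ =>
    intro Δ r γ δ h
    change scanrArr (fun a b => (e₁.rename r.lift.lift).den ((δ, a), b)) ((e₂.rename r).den δ) _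
      ((e₃.rename r).den δ) = scanrArr (fun a b => e₁.den ((γ, a), b)) (e₂.den γ) _ (e₃.den γ)
    rw [ih₂ h, ih₃ h]
    exact congrArg (fun m => scanrArr m _ _ _) (funext₂ fun a b => ih₁ ((h.lift a).lift b))
  | shift1L e ih => exact fun h => congrArg (shiftLArr _) (ih h)
  | shift1R e ih => exact fun h => congrArg (shiftRArr _) (ih h)

theorem den_wk {Γ : TCtx} {A B : Ty} (t : Tm S Γ A) (γ : TCtx.Env Γ) (b : B.den) :
    (t.wk (B := B)).den (γ, b) = t.den γ :=
  t.den_rename ((Ren.sel_id γ).wk b)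

theorem den_wk₂ {Γ : TCtx} {A B C : Ty} (t : Tm S Γ A) (γ : TCtx.Env Γ) (b : B.den) (c : C.den) :
    (t.wk₂ (B := B) (C := C)).den ((γ, b), c) = t.den γ :=
  (t.wk.den_wk _ _).trans (t.den_wk γ b)

theorem den_vars {Δ : TCtx} : {Γ : SCtx} → {v : SRen Γ Δ} → {γ : TCtx.Env Γ.emb} →
    {δ : TCtx.Env Δ} → v.Sel γ δ → (vars (S := S) Γ v).den δ = γ
  | .nil => fun _ => rfl
  | Γ ▹ _ => fun h => Prod.ext (den_vars (Γ := Γ) fun _ i => h (.succ i)) (h .zero)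

theorem den_zero {Δ : TCtx} (δ : TCtx.Env Δ) : (A : STy) → (zero (S := S) A).den δ = A.zeroV
  | .real => rfl
  | .prod A B => Prod.ext (den_zero δ A) (den_zero δ B)
  | .arr _ => rfl

theorem den_add {Δ : TCtx} (δ : TCtx.Env Δ) : (A : STy) → (a b : Tm S Δ A.emb) →
    (add A a b).den δ = A.addV (a.den δ) (b.den δ)
  | .real => fun _ _ => S.den_add _ _
  | .prod A B => fun a b =>
    Prod.ext (den_add δ A (fst a) (fst b)) (den_add δ B (snd a) (snd b))
  | .arr _ => fun _ _ => funext fun _ => S.den_add _ _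

theorem den_smul {Δ : TCtx} (δ : TCtx.Env Δ) : (A : STy) → (r : Tm S Δ .real) →
    (b : Tm S Δ A.emb) → (smul A r b).den δ = A.smulV (r.den δ) (b.den δ)
  | .real => fun _ _ => S.den_mul _ _
  | .prod A B => fun r b => Prod.ext (den_smul δ A r (fst b)) (den_smul δ B r (snd b))
  | .arr _ => fun r _ => funext fun _ =>
    (S.den_mul _ _).trans (congrArg (fun x : ℝ => x * _) (r.den_wk₂ δ _ _))

theorem den_zeroC {Δ : TCtx} (δ : TCtx.Env Δ) : (Γ : SCtx) →
    (zeroC (S := S) Γ).den δ = SCtx.zeroV Γ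
  | .nil => rfl
  | Γ ▹ A => Prod.ext (den_zeroC δ Γ) (den_zero δ A)

theorem den_addC {Δ : TCtx} (δ : TCtx.Env Δ) : (Γ : SCtx) → (a b : Tm S Δ (tup Γ.emb)) →
    (addC Γ a b).den δ = SCtx.addV Γ (a.den δ) (b.den δ)
  | .nil => fun _ _ => rfl
  | Γ ▹ A => fun a b => Prod.ext (den_addC δ Γ (fst a) (fst b)) (den_add δ A (snd a) (snd b))

theorem den_smulC {Δ : TCtx} (δ : TCtx.Env Δ) : (Γ : SCtx) → (r : Tm S Δ .real) →
    (b : Tm S Δ (tup Γ.emb)) → (smulC Γ r b).den δ = SCtx.smulV Γ (r.den δ) (b.den δ)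
  | .nil => fun _ _ => rfl
  | Γ ▹ A => fun r b => Prod.ext (den_smulC δ Γ r (fst b)) (den_smul δ A r (snd b))

theorem den_hot {Δ : TCtx} (δ : TCtx.Env Δ) {A : STy} : {Γ : SCtx} → (i : Var Γ A) →
    (a : Tm S Δ A.emb) → (hot i a).den δ = SCtx.hotV i (a.den δ)
  | Γ ▹ _, .zero => fun _ => Prod.ext (den_zeroC δ Γ) rfl
  | _ ▹ B, .succ i => fun a => Prod.ext (den_hot δ i a) (den_zero δ B)

theorem den_padZero {Δ : TCtx} (δ : TCtx.Env Δ) {Γ : SCtx} : (Θ : SCtx) →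
    (t : Tm S Δ (tup Γ.emb)) → (padZero Θ t).den δ = SCtx.padV Θ (t.den δ)
  | .nil => fun _ => rfl
  | Θ ▹ A => fun t => Prod.ext (den_padZero δ Θ t) (den_zero δ A)

theorem den_backFun {Δ : TCtx} {ρ R : Ty} {Γ : SCtx} {A : STy} {Y : Var Δ (.fn R ρ)}
    {args : Tm S (Δ.append Γ.emb ▹ A.emb) R} {δ : TCtx.Env Δ} {x : TCtx.Env (SCtx.emb (Γ ▹ A))}
    {a : R.den} (h : args.den (appendEnv Γ.emb δ x.1, x.2) = a) :
    SmoothMap.toFun ((backFun Γ A Y args).den δ) x = SmoothMap.toFun (Y.val δ) a :=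
  congrArg₂ SmoothMap.toFun (Ren.sel_inl δ Γ.emb x.1 Y) h

theorem den_backVars {Δ : TCtx} {Γ : SCtx} {A : Ty} (δ : TCtx.Env Δ) (x : TCtx.Env Γ.emb)
    (a : A.den) : (backVars (S := S) (Δ := Δ) Γ A).den (appendEnv Γ.emb δ x, a) = x :=
  den_vars (((SRen.sel_id x).andThen (Ren.sel_inr δ Γ.emb x)).wk a)

end Tm

/-- Weakening by the variables bound by `backFun` does not change the value of a term. -/
theorem Ren.sel_back {Δ : TCtx} {Γ : SCtx} {A : Ty} (δ : TCtx.Env Δ) (x : TCtx.Env Γ.emb)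
    (a : A.den) : (Ren.back (Δ := Δ) Γ A).Sel δ (appendEnv Γ.emb δ x, a) :=
  (Ren.sel_inl δ Γ.emb x).wk a

/-! ### Source terms under embedding into the target language and under renaming. -/

namespace Src

variable {S : Signature.{u}}

theorem den_toTm {Γ : SCtx} {A : STy} (e : Src S Γ A) : ∀ {Δ : TCtx} {v : SRen Γ Δ}
    {γ : TCtx.Env Γ.emb} {δ : TCtx.Env Δ}, v.Sel γ δ → (e.toTm v).den δ = e.den γ := by
  induction e with
  | var i => exact fun h => h i
  | cst c => exact fun _ => rfl
  | let_ e₁ e₂ ih₁ ih₂ =>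
    intro Δ v γ δ h
    change (e₂.toTm v.lift).den (δ, (e₁.toTm v).den δ) = e₂.den (γ, e₁.den γ)
    rw [ih₁ h]; exact ih₂ (h.lift _)
  | pair e₁ e₂ ih₁ ih₂ => exact fun h => Prod.ext (ih₁ h) (ih₂ h)
  | fst e ih => exact fun h => congrArg Prod.fst (ih h)
  | snd e ih => exact fun h => congrArg Prod.snd (ih h)
  | op1 f e ih => exact fun h => congrArg (S.den1 f) (ih h)
  | op2 g e₁ e₂ ih₁ ih₂ => exact fun h => congrArg₂ (S.den2 g) (ih₁ h) (ih₂ h)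
  | map2 e₁ e₂ e₃ ih₁ ih₂ ih₃ =>
    intro Δ v γ δ h
    funext i
    change (e₁.toTm v.lift.lift).den ((δ, (e₂.toTm v).den δ i), (e₃.toTm v).den δ i) =
      e₁.den ((γ, e₂.den γ i), e₃.den γ i)
    rw [ih₂ h, ih₃ h]; exact ih₁ ((h.lift (B := .real) _).lift (B := .real) _)
  | reduce e₁ e₂ e₃ ih₁ ih₂ ih₃ =>
    intro Δ v γ δ h
    change foldArr (fun a b => (e₁.toTm (SRen.empty Δ).lift.lift).den ((δ, a), b))
      ((e₂.toTm v).den δ) _ ((e₃.toTm v).den δ) =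
        foldArr (fun a b : ℝ => e₁.den ((PUnit.unit, a), b)) (e₂.den γ) _ (e₃.den γ)
    rw [ih₂ h, ih₃ h]
    exact congrArg (fun m => foldArr m _ _ _) (funext₂ fun a b =>
      ih₁ (((SRen.sel_empty δ).lift (B := .real) a).lift (B := .real) b))

theorem den_rename {Γ : SCtx} {A : STy} (e : Src S Γ A) : ∀ {Δ : SCtx} (s : Ren Γ Δ)
    (δ : TCtx.Env Δ.emb), (e.rename s).den δ = e.den (SCtx.pull s δ) := by
  induction e with
  | var i => exact fun s δ => (SCtx.get_pull s i δ).symm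
  | cst c => exact fun _ _ => rfl
  | let_ e₁ e₂ ih₁ ih₂ =>
    intro Δ s δ
    refine (ih₂ _ _).trans ?_
    rw [SCtx.pull_lift, ih₁]; rfl
  | pair e₁ e₂ ih₁ ih₂ => exact fun s δ => Prod.ext (ih₁ s δ) (ih₂ s δ)
  | fst e ih => exact fun s δ => congrArg Prod.fst (ih s δ)
  | snd e ih => exact fun s δ => congrArg Prod.snd (ih s δ)
  | op1 f e ih => exact fun s δ => congrArg (S.den1 f) (ih s δ)
  | op2 g e₁ e₂ ih₁ ih₂ => exact fun s δ => congrArg₂ (S.den2 g) (ih₁ s δ) (ih₂ s δ)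
  | map2 e₁ e₂ e₃ ih₁ ih₂ ih₃ =>
    intro Δ s δ
    funext i
    exact (ih₁ _ _).trans (congrArg e₁.den ((SCtx.pull_lift₂ s δ _ _).trans
      (congrArg₂ (fun a b => ((SCtx.pull s δ, a i), b i)) (ih₂ s δ) (ih₃ s δ))))
  | reduce e₁ e₂ e₃ ih₁ ih₂ ih₃ =>
    exact fun s δ => congrArg₂ (fun a v => foldArr _ a _ v) (ih₂ s δ) (ih₃ s δ)

theorem ReduceOK.rename {Γ : SCtx} {A : STy} {e : Src S Γ A} (h : e.ReduceOK) :
    ∀ {Δ : SCtx} (s : Ren Γ Δ), (e.rename s).ReduceOK := by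
  induction e with
  | var i => exact fun _ => trivial
  | cst c => exact fun _ => trivial
  | let_ e₁ e₂ ih₁ ih₂ => exact fun s => ⟨ih₁ h.1 s, ih₂ h.2 s.lift⟩
  | pair e₁ e₂ ih₁ ih₂ => exact fun s => ⟨ih₁ h.1 s, ih₂ h.2 s⟩
  | fst e ih => exact fun s => ih h s
  | snd e ih => exact fun s => ih h s
  | op1 f e ih => exact fun s => ih h s
  | op2 g e₁ e₂ ih₁ ih₂ => exact fun s => ⟨ih₁ h.1 s, ih₂ h.2 s⟩
  | map2 e₁ e₂ e₃ ih₁ ih₂ ih₃ =>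
    exact fun s => ⟨ih₁ h.1 s.lift.lift, ih₂ h.2.1 s, ih₃ h.2.2 s⟩
  | reduce e₁ e₂ e₃ ih₁ ih₂ ih₃ =>
    refine fun s => ⟨⟨h.1.1, fun γ a => ?_⟩, h.2.1, ih₂ h.2.2.1 s, ih₃ h.2.2.2 s⟩
    -- A renamed initial value is the old one at the pulled-back environment, and the unit law is
    -- assumed at all environments.
    rw [e₂.den_rename]; exact h.1.2 _ a

end Src

/-! ### Transposed derivatives along curves -/

/-- `G` is the transposed derivative of `f` at `γ`: along each curve through `γ` with a velocity
the image curve has a velocity, and `G` is adjoint to the map between the velocities. -/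
def IsVJP {Γ Δ : SCtx} (f : TCtx.Env Γ.emb → TCtx.Env Δ.emb) (γ : TCtx.Env Γ.emb)
    (G : TCtx.Env Δ.emb → TCtx.Env Γ.emb) : Prop :=
  ∀ (c : ℝ → TCtx.Env Γ.emb) (c' : TCtx.Env Γ.emb), c 0 = γ → Γ.HasVel c c' →
    ∃ d, Δ.HasVel (fun t => f (c t)) d ∧ ∀ z, Γ.dot (G z) c' = Δ.dot z d

/-- The image under `f` of a test curve is itself a test curve at `f γ`, so the second hypothesis
applies to it directly and the two adjunctions chain. -/
theorem IsVJP.comp {Γ Δ Θ : SCtx} {f : TCtx.Env Γ.emb → TCtx.Env Δ.emb}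
    {h : TCtx.Env Δ.emb → TCtx.Env Θ.emb} {γ : TCtx.Env Γ.emb}
    {G : TCtx.Env Δ.emb → TCtx.Env Γ.emb} {H : TCtx.Env Θ.emb → TCtx.Env Δ.emb}
    (hH : IsVJP h (f γ) H) (hG : IsVJP f γ G) :
    IsVJP (fun x => h (f x)) γ (fun z => G (H z)) := by
  intro c c' h0 hc
  obtain ⟨d, hd, hGd⟩ := hG c c' h0 hc
  obtain ⟨k, hk, hHk⟩ := hH (fun t => f (c t)) d (congrArg f h0) hd
  exact ⟨k, hk, fun z => (hGd _).trans (hHk z)⟩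

/-- `g` is the gradient of `f` at `γ`. -/
def IsGrad {Γ : SCtx} (f : TCtx.Env Γ.emb → ℝ) (γ g : TCtx.Env Γ.emb) : Prop :=
  ∀ (c : ℝ → TCtx.Env Γ.emb) (c' : TCtx.Env Γ.emb), c 0 = γ → Γ.HasVel c c' →
    HasDerivAt (fun t => f (c t)) (Γ.dot g c') 0

/-- The cotangent (0, 1) pairs with a velocity of `⟨Id, f⟩` to give just the velocity of `f`. -/
theorem IsVJP.isGrad {Γ : SCtx} {f : TCtx.Env Γ.emb → ℝ} {γ : TCtx.Env Γ.emb}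
    {G : TCtx.Env (SCtx.emb (Γ ▹ .real)) → TCtx.Env Γ.emb}
    (h : IsVJP (Δ := Γ ▹ .real) (fun x => (x, f x)) γ G) :
    IsGrad f γ (G (SCtx.zeroV Γ, (1 : ℝ))) := by
  intro c c' h0 hc
  obtain ⟨d, hd, hG⟩ := h c c' h0 hc
  have h1 : Γ.dot (G (SCtx.zeroV Γ, (1 : ℝ))) c' = d.2 :=
    (hG _).trans ((congrArg₂ (· + ·) (SCtx.dot_zeroV Γ d.1) (one_mul (M := ℝ) d.2)).trans
      (zero_add _))
  rw [h1]
  exact hd.2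

/-! ### Derivatives of the scalar operations along curves. -/

namespace Signature

variable (S : Signature.{u})

theorem hasDerivAt_op1 (f : S.Op1) {a : ℝ → ℝ} {a' : ℝ} (ha : HasDerivAt a a' 0) :
    HasDerivAt (fun t => S.den1 f (a t)) (S.den1 (S.d f) (a 0) * a') 0 := by
  rw [S.den_d]
  exact (((S.smooth1 f).differentiable (by simp)) (a 0)).hasDerivAt.comp (0 : ℝ) ha

theorem hasDerivAt_op2 (g : S.Op2) {a b : ℝ → ℝ} {a' b' : ℝ} (ha : HasDerivAt a a' 0)
    (hb : HasDerivAt b b' 0) :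
    HasDerivAt (fun t => S.den2 g (a t) (b t))
      (S.den2 (S.d₁ g) (a 0) (b 0) * a' + S.den2 (S.d₂ g) (a 0) (b 0) * b') 0 := by
  have hL := ((S.smooth2 g).differentiable (by simp) (a 0, b 0)).hasFDerivAt
  set L := fderiv ℝ (fun p : ℝ × ℝ => S.den2 g p.1 p.2) (a 0, b 0)
  -- The partial derivatives named by the signature are the values of the total differential `L` on
  -- the two basis vectors.
  have h₁ : HasDerivAt (fun t => S.den2 g t (b 0)) (L (1, 0)) (a 0) :=
    HasFDerivAt.comp_hasDerivAt (l := fun p : ℝ × ℝ => S.den2 g p.1 p.2) (a 0) hL ((hasDerivAt_id (a 0)).prodMk (hasDerivAt_const _ (b 0)))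
  have h₂ : HasDerivAt (fun t => S.den2 g (a 0) t) (L (0, 1)) (b 0) :=
    HasFDerivAt.comp_hasDerivAt (l := fun p : ℝ × ℝ => S.den2 g p.1 p.2) (b 0) hL ((hasDerivAt_const _ (a 0)).prodMk (hasDerivAt_id (b 0)))
  have h : HasDerivAt (fun t => S.den2 g (a t) (b t)) (L (a', b')) 0 :=
    HasFDerivAt.comp_hasDerivAt (l := fun p : ℝ × ℝ => S.den2 g p.1 p.2) (0 : ℝ) hL (ha.prodMk hb)
  have hL' : L (a', b') = L (1, 0) * a' + L (0, 1) * b' := by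
    have : ((a', b') : ℝ × ℝ) = a' • (1, 0) + b' • (0, 1) := by simp
    rw [this, map_add, map_smul, map_smul, smul_eq_mul, smul_eq_mul, mul_comm a', mul_comm b']
  rw [S.den_d₁, S.den_d₂, h₁.deriv, h₂.deriv, ← hL']
  exact h

end Signature

/-! ### Derivatives of folds -/

/-- The prefixes of a fold. -/
def foldPrefix {A B : Type} (f : A → B → A) (a : A) {n : ℕ} (v : Fin n → B) (i : Fin n) : A :=
  foldArr f a i.val fun j => v (Fin.castLE i.isLt.le j)

theorem foldArr_congr {A B : Type} {f f' : A → B → A} {a a' : A} {n : ℕ} {v v' : Fin n → B}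
    (hf : ∀ x y, f x y = f' x y) (ha : a = a') (hv : ∀ i, v i = v' i) :
    foldArr f a n v = foldArr f' a' n v' := by
  rw [funext₂ hf, ha, funext hv]

/-- Here `p` and `q` are the partial derivatives of `m` in the accumulator and in the entry. A
perturbation of entry `i` enters through `q` at step `i` and is then multiplied by `p` at each later
step. -/
theorem hasDerivAt_foldArr {m p q : ℝ → ℝ → ℝ} (hm : ∀ (a b : ℝ → ℝ) (a' b' : ℝ),
      HasDerivAt a a' 0 → HasDerivAt b b' 0 →
        HasDerivAt (fun t => m (a t) (b t)) (p (a 0) (b 0) * a' + q (a 0) (b 0) * b') 0)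
    (u : ℝ) (n : ℕ) (v : ℝ → Fin n → ℝ) (v' : Fin n → ℝ)
    (hv : ∀ i, HasDerivAt (fun t => v t i) (v' i) 0) :
    HasDerivAt (fun t => foldArr m u n (v t))
      (∑ i, q (foldPrefix m u (v 0) i) (v 0 i) *
        (∏ k, if i < k then p (foldPrefix m u (v 0) k) (v 0 k) else 1) * v' i) 0 := by
  induction n with
  | zero => exact (hasDerivAt_const (0 : ℝ) u).congr_deriv (by simp)
  | succ n ih =>
    have h := hm _ _ _ _ (ih (fun t i => v t i.castSucc) (fun i => v' i.castSucc)
      fun i => hv i.castSucc) (hv (Fin.last n))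
    refine h.congr_deriv ?_
    rw [Fin.sum_univ_castSucc, Finset.mul_sum]
    congr 1
    · refine Finset.sum_congr rfl fun i _ => ?_
      -- For an earlier entry the new step contributes exactly one more factor `p`, split off from
      -- the product.
      rw [Fin.prod_univ_castSucc, if_pos (Fin.castSucc_lt_last i)]
      simp only [Fin.castSucc_lt_castSucc_iff]
      change _ = q (foldPrefix m u (fun i => v 0 i.castSucc) i) (v 0 i.castSucc) *
        ((∏ k : Fin n, if i < k then p (foldPrefix m u (fun i => v 0 i.castSucc) k)
          (v 0 k.castSucc) else 1) * p (foldArr m u n fun i => v 0 i.castSucc)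
            (v 0 (Fin.last n))) * v' i.castSucc
      ring
    -- Nothing follows the last entry, so its product is 1.
    · rw [Finset.prod_eq_one fun k _ => if_neg (Fin.le_last k).not_gt, mul_one]
      rfl

theorem foldArr_mul (n : ℕ) (v : Fin n → ℝ) : foldArr (fun a b => a * b) 1 n v = ∏ i, v i := by
  induction n with
  | zero => rfl
  | succ n ih => rw [Fin.prod_univ_castSucc, ← ih]; rfl

/-- The scanned array omits entry 0 of `v`: no suffix product over `k > i` contains it. The scan
still has `n + 1` entries, the last being the empty product 1. -/
theorem scanrArr_mul (n : ℕ) (v : Fin (n + 1) → ℝ) (i : Fin (n + 1)) :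
    scanrArr (fun a b => a * b) 1 n (fun j => v j.succ) i = ∏ k, if i < k then v k else 1 := by
  refine (foldArr_mul _ _).trans ?_
  rw [← Finset.prod_filter]
  -- The scan at `i` multiplies the last `n - i` entries, from the right: its factor number `j` is
  -- the entry of `v` at `n - j`.
  refine Finset.prod_bij (fun j _ => (Fin.castLE (Nat.lt_succ_iff.mp i.rev.isLt) j).rev.succ)
    ?_ ?_ ?_ fun _ _ => rfl
  · intro j _
    have := j.isLt
    simp only [Finset.mem_filter, Finset.mem_univ, true_and, Fin.lt_def, Fin.val_succ,
      Fin.val_rev, Fin.val_castLE] at this ⊢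
    omega
  · intro j _ k _ h
    simpa using h
  · intro k hk
    have hk : i.val < k.val := (Finset.mem_filter.mp hk).2
    have hk' := k.isLt
    -- The inverse of `j ↦ n - j`; it is in range because `i < k`.
    refine ⟨⟨n - k.val, ?_⟩, Finset.mem_univ _, Fin.ext ?_⟩
    · simp only [Fin.val_rev]; omega
    · simp only [Fin.val_succ, Fin.val_rev, Fin.val_castLE]; omega

theorem SCtx.dot_foldArr {Γ : SCtx} (n : ℕ) (w : Fin n → TCtx.Env Γ.emb) (c : TCtx.Env Γ.emb) :
    Γ.dot (foldArr (SCtx.addV Γ) (SCtx.zeroV Γ) n w) c = ∑ i, Γ.dot (w i) c := by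
  induction n with
  | zero => exact SCtx.dot_zeroV Γ c
  | succ n ih =>
    rw [Fin.sum_univ_castSucc, ← ih]
    exact SCtx.dot_addV Γ _ _ _

/-! ### Values of the gradient terms for `map2` and `reduce`. -/

namespace Tm

variable {S : Signature.{u}} {Δ : TCtx}

/-- If the continuation of `t` is `Y ∘ G` for every `Y`, then the identity continuation exposes `G`
itself, evaluated at (0, 1). -/
theorem den_runGrad {Γ : SCtx} {t : Tm S (Δ ▹ .fn (tup Γ.emb) (tup Γ.emb))
      (.prod .real (.fn (tup (SCtx.emb (Γ ▹ .real))) (tup Γ.emb)))} {δ : TCtx.Env Δ}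
    {G : TCtx.Env (SCtx.emb (Γ ▹ .real)) → TCtx.Env Γ.emb}
    (h : ∀ (Y : SmoothMap (TCtx.Env Γ.emb) (TCtx.Env Γ.emb)) (x),
      SmoothMap.toFun (t.den (δ, Y)).2 x = Y (G x)) :
    (runGrad Γ t).den δ = G (SCtx.zeroV Γ, (1 : ℝ)) := by
  refine (h ((idCont (S := S) Γ).den δ) _).trans
    ((den_vars ((SRen.sel_id _).andThen (Ren.sel_inr δ Γ.emb _))).trans (congrArg G ?_))
  exact Prod.ext (den_zeroC _ Γ) rfl

theorem den_map2BackΓ {n : ℕ} {Γ : SCtx}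
    {g : Tm S (Δ ▹ .real ▹ .real) (tup (SCtx.emb (Γ ▹ .real ▹ .real)))}
    {A B Z : Tm S Δ (.arr .real n)} {δ : TCtx.Env Δ} {a b z : Fin n → ℝ}
    {w : Fin n → TCtx.Env (SCtx.emb (Γ ▹ .real ▹ .real))}
    (hA : A.den δ = a) (hB : B.den δ = b) (hZ : Z.den δ = z)
    (hg : ∀ i, g.den ((δ, a i), b i) = w i) :
    (map2BackΓ Γ g A B Z).den δ =
      foldArr (SCtx.addV Γ) (SCtx.zeroV Γ) n fun i => SCtx.smulV Γ (z i) (w i).1.1 := by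
  subst hA hB hZ
  refine foldArr_congr (fun x y => den_addC _ Γ _ _) (den_zeroC _ Γ) fun i => ?_
  exact (den_smulC _ Γ _ _).trans
    (congrArg (fun w : TCtx.Env (SCtx.emb (Γ ▹ .real ▹ .real)) => SCtx.smulV Γ _ w.1.1) (hg i))

theorem den_map2Back₁ {n : ℕ} {Γ : SCtx}
    {g : Tm S (Δ ▹ .real ▹ .real) (tup (SCtx.emb (Γ ▹ .real ▹ .real)))}
    {A B Z : Tm S Δ (.arr .real n)} {δ : TCtx.Env Δ} {a b z : Fin n → ℝ}
    {w : Fin n → TCtx.Env (SCtx.emb (Γ ▹ .real ▹ .real))}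
    (hA : A.den δ = a) (hB : B.den δ = b) (hZ : Z.den δ = z)
    (hg : ∀ i, g.den ((δ, a i), b i) = w i) :
    (map2Back₁ Γ g A B Z).den δ = fun i => @HMul.hMul ℝ ℝ ℝ _ (w i).1.2 (z i) := by
  subst hA hB hZ
  exact funext fun i => (S.den_mul _ _).trans
    (congrArg (fun w : TCtx.Env (SCtx.emb (Γ ▹ .real ▹ .real)) => @HMul.hMul ℝ ℝ ℝ _ w.1.2 _) (hg i))

theorem den_map2Back₂ {n : ℕ} {Γ : SCtx}
    {g : Tm S (Δ ▹ .real ▹ .real) (tup (SCtx.emb (Γ ▹ .real ▹ .real)))}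
    {A B Z : Tm S Δ (.arr .real n)} {δ : TCtx.Env Δ} {a b z : Fin n → ℝ}
    {w : Fin n → TCtx.Env (SCtx.emb (Γ ▹ .real ▹ .real))}
    (hA : A.den δ = a) (hB : B.den δ = b) (hZ : Z.den δ = z)
    (hg : ∀ i, g.den ((δ, a i), b i) = w i) :
    (map2Back₂ Γ g A B Z).den δ = fun i => @HMul.hMul ℝ ℝ ℝ _ (w i).2 (z i) := by
  subst hA hB hZ
  exact funext fun i => (S.den_mul _ _).trans
    (congrArg (fun w : TCtx.Env (SCtx.emb (Γ ▹ .real ▹ .real)) => @HMul.hMul ℝ ℝ ℝ _ w.2 _) (hg i))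

theorem den_reduceTape {n : ℕ} {e₁ : Tm S (Δ ▹ .real ▹ .real) .real}
    {g : Tm S (Δ ▹ .real ▹ .real) (tup (SCtx.emb (.nil ▹ .real ▹ .real)))}
    {y₁ : Tm S Δ .real} {A : Tm S Δ (.arr .real n)} {δ : TCtx.Env Δ} {m : ℝ → ℝ → ℝ}
    {w : ℝ → ℝ → TCtx.Env (SCtx.emb (.nil ▹ .real ▹ .real))} {u : ℝ} {v : Fin n → ℝ}
    (hm : ∀ a b : ℝ, e₁.den ((δ, a), b) = m a b) (hg : ∀ a b : ℝ, g.den ((δ, a), b) = w a b)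
    (hy : y₁.den δ = u) (hA : A.den δ = v) :
    (reduceTape e₁ g y₁ A).den δ =
      ((fun i => (w (foldPrefix m u v i) (v i)).2 : Fin n → ℝ),
        (fun i => ∏ k, if i < k then (w (foldPrefix m u v k) (v k)).1.2 else 1 : Fin n → ℝ)) := by
  subst hy hA
  cases n with
  | zero => exact Prod.ext (funext fun i => i.elim0) (funext fun i => i.elim0)
  | succ n =>
    have hm' : (fun a b : ℝ => e₁.den ((δ, a), b)) = m := funext₂ hm
    subst hm'
    have hg₁ : ∀ (x : (Ty.arr .real (n + 1)).den) (a b : ℝ),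
        (g.rename (Ren.id Δ).wk.lift.lift).den (((δ, x), a), b) = w a b := fun x a b =>
      (g.den_rename ((((Ren.sel_id δ).wk x).lift (B := .real) a).lift (B := .real) b)).trans
        (hg a b)
    have hg₂ : ∀ (x : (Ty.arr .real (n + 1)).den) (y : (Ty.arr .real n).den) (a b : ℝ),
        (g.rename (Ren.id Δ).wk.wk.lift.lift).den ((((δ, x), y), a), b) = w a b :=
      fun x y a b =>
      (g.den_rename (((((Ren.sel_id δ).wk x).wk y).lift (B := .real) a).lift (B := .real) b)).trans
        (hg a b)
    refine Prod.ext (funext fun i => ?_) (funext fun i => ?_)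
    -- The left scan has one entry too many, the complete fold. With it dropped, entry `i` is by
    -- unfolding the accumulator just before step `i`, that is, `foldPrefix`.
    · exact congrArg Prod.snd ((hg₂ _ _ _ _).trans
        (congrArg (w _) (congrFun (A.den_wk₂ δ _ _) i)))
    -- After multiplication is unfolded, the left shift makes `j.succ` the index of the scanned
    -- entries, the form required by `scanrArr_mul`.
    · refine (congrArg (fun f => scanrArr f (1 : ℝ) n _ i) (funext₂ fun a b => S.den_mul a b)).trans
        ((congrArg (fun f => scanrArr (fun a b : ℝ => a * b) (1 : ℝ) n f i)
          (funext fun j => ?_)).trans (scanrArr_mul n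
            (fun k => (w (foldPrefix (fun a b => e₁.den ((δ, a), b)) (y₁.den δ) (A.den δ) k)
              (A.den δ k)).1.2) i))
      exact congrArg (fun x : TCtx.Env (SCtx.emb (.nil ▹ .real ▹ .real)) => x.1.2)
        ((hg₁ _ _ _).trans (congrArg (w _) (congrFun (A.den_wk δ _) j.succ)))

theorem den_reduceBack {n : ℕ} {p : Tm S Δ (.prod (.arr .real n) (.arr .real n))}
    {z : Tm S Δ .real} {δ : TCtx.Env Δ} {a b : Fin n → ℝ} {r : ℝ} (hp : p.den δ = (a, b))
    (hz : z.den δ = r) : (reduceBack p z).den δ = fun i => a i * b i * r := by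
  subst hz
  refine funext fun i => (S.den_mul _ _).trans (congrArg₂ (fun x y : ℝ => x * y) ?_
    (z.den_wk₂ δ _ _))
  exact (S.den_mul _ _).trans
    (congrArg (fun q : (Fin n → ℝ) × (Fin n → ℝ) => q.1 i * q.2 i) hp)

end Tm

/-! ### Differentials of the primitive operations -/

/-- Along each curve through `γ` with velocity `c'` the image curve under `f` has a velocity, whose
inner product with `z` is `K z c'`. -/
def IsDifferential {Γ : SCtx} {A : STy} (f : TCtx.Env Γ.emb → A.emb.den) (γ : TCtx.Env Γ.emb)
    (K : A.emb.den → TCtx.Env Γ.emb → ℝ) : Prop :=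
  ∀ (c : ℝ → TCtx.Env Γ.emb) (c' : TCtx.Env Γ.emb), c 0 = γ → Γ.HasVel c c' →
    ∃ d, A.HasVel (fun t => f (c t)) d ∧ ∀ z, K z c' = A.dot z d

/-- Separates the newly computed value from the part `r` of the context that is kept. The same
differential then serves the UNF primitives, which mostly keep their arguments, and the direct
transformation, which drops them. -/
theorem IsDifferential.isVJP {Γ Θ : SCtx} {A : STy} {f : TCtx.Env Γ.emb → A.emb.den}
    {γ : TCtx.Env Γ.emb} {K : A.emb.den → TCtx.Env Γ.emb → ℝ} (h : IsDifferential f γ K)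
    {r : TCtx.Env Γ.emb → TCtx.Env Θ.emb}
    (hr : ∀ c c', Γ.HasVel c c' → Θ.HasVel (fun t => r (c t)) (r c'))
    {G : TCtx.Env (SCtx.emb (Θ ▹ A)) → TCtx.Env Γ.emb}
    (hG : ∀ z c', Γ.dot (G z) c' = Θ.dot z.1 (r c') + K z.2 c') :
    IsVJP (Δ := Θ ▹ A) (fun x => (r x, f x)) γ G := by
  intro c c' h0 hc
  obtain ⟨d, hd, hK⟩ := h c c' h0 hc
  exact ⟨(r c', d), ⟨hr c c' hc, hd⟩, fun z => (hG z c').trans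
    (congrArg (Θ.dot z.1 (r c') + ·) (hK z.2))⟩

theorem IsVJP.congr {Γ Δ : SCtx} {f f' : TCtx.Env Γ.emb → TCtx.Env Δ.emb} {γ : TCtx.Env Γ.emb}
    {G : TCtx.Env Δ.emb → TCtx.Env Γ.emb} (h : IsVJP f γ G) (hf : ∀ x, f x = f' x) :
    IsVJP f' γ G :=
  (funext hf : f = f') ▸ h

section Differentials

variable {S : Signature.{u}} {Γ : SCtx} {A B : STy}

theorem isDifferential_get (i : Var Γ A) (γ : TCtx.Env Γ.emb) :
    IsDifferential i.get γ (fun z c' => A.dot z (i.get c')) :=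
  fun _ c' _ hc => ⟨i.get c', SCtx.hasVel_get i hc, fun _ => rfl⟩

theorem isDifferential_const (a : ℝ) (γ : TCtx.Env Γ.emb) :
    IsDifferential (A := .real) (fun _ => a) γ (fun _ _ => 0) :=
  fun _ _ _ _ => ⟨(0 : ℝ), hasDerivAt_const (0 : ℝ) a, fun z => (mul_zero (M₀ := ℝ) z).symm⟩

theorem isDifferential_fst (γ : TCtx.Env (SCtx.emb (Γ ▹ .prod A B))) :
    IsDifferential (Γ := Γ ▹ .prod A B) (A := A) (fun x => x.2.1) γ
      (fun z c' => A.dot z c'.2.1) :=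
  fun _ c' _ hc => ⟨c'.2.1, hc.2.1, fun _ => rfl⟩

theorem isDifferential_snd (γ : TCtx.Env (SCtx.emb (Γ ▹ .prod A B))) :
    IsDifferential (Γ := Γ ▹ .prod A B) (A := B) (fun x => x.2.2) γ
      (fun z c' => B.dot z c'.2.2) :=
  fun _ c' _ hc => ⟨c'.2.2, hc.2.2, fun _ => rfl⟩

theorem isDifferential_pair (γ : TCtx.Env (SCtx.emb (Γ ▹ A ▹ B))) :
    IsDifferential (Γ := Γ ▹ A ▹ B) (A := .prod A B) (fun x => (x.1.2, x.2)) γ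
      (fun z c' => A.dot z.1 c'.1.2 + B.dot z.2 c'.2) :=
  fun _ c' _ hc => ⟨(c'.1.2, c'.2), ⟨hc.1.2, hc.2⟩, fun _ => rfl⟩

theorem isDifferential_op1 (f : S.Op1) (γ : TCtx.Env (SCtx.emb (Γ ▹ .real))) :
    IsDifferential (Γ := Γ ▹ .real) (A := .real) (fun x => S.den1 f x.2) γ
      (fun z c' => @HMul.hMul ℝ ℝ ℝ _ (@HMul.hMul ℝ ℝ ℝ _ (S.den1 (S.d f) γ.2) z) c'.2) := by
  intro c c' h0 hc
  subst h0
  -- Stated for plain reals because the components of environments have type `ℝ` only after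
  -- unfolding. The auxiliary identities named `key` below serve the same purpose.
  have key : ∀ m z a : ℝ, m * z * a = z * (m * a) := fun m z a => by ring
  exact ⟨_, S.hasDerivAt_op1 f hc.2, fun z => key _ z c'.2⟩

theorem isDifferential_op2 (g : S.Op2) (γ : TCtx.Env (SCtx.emb (Γ ▹ .real ▹ .real))) :
    IsDifferential (Γ := Γ ▹ .real ▹ .real) (A := .real) (fun x => S.den2 g x.1.2 x.2) γ
      (fun z c' =>
        @HMul.hMul ℝ ℝ ℝ _ (@HMul.hMul ℝ ℝ ℝ _ (S.den2 (S.d₁ g) γ.1.2 γ.2) z) c'.1.2 +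
        @HMul.hMul ℝ ℝ ℝ _ (@HMul.hMul ℝ ℝ ℝ _ (S.den2 (S.d₂ g) γ.1.2 γ.2) z) c'.2) := by
  intro c c' h0 hc
  subst h0
  have key : ∀ m n z a b : ℝ, m * z * a + n * z * b = z * (m * a + n * b) :=
    fun m n z a b => by ring
  exact ⟨_, S.hasDerivAt_op2 g hc.1.2 hc.2, fun z => key _ _ z c'.1.2 c'.2⟩

/-- The context is shared by all `n` applications of `f`, so its cotangent is a sum over `i`. Each
array entry is read by a single application, so the array cotangents are pointwise. -/
theorem isDifferential_map2 {n : ℕ} {f : TCtx.Env (SCtx.emb (Γ ▹ .real ▹ .real)) → ℝ}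
    {γ : TCtx.Env (SCtx.emb (Γ ▹ .arr n ▹ .arr n))}
    {w : Fin n → TCtx.Env (SCtx.emb (Γ ▹ .real ▹ .real))}
    (hw : ∀ i : Fin n, IsGrad (Γ := Γ ▹ .real ▹ .real) f ((γ.1.1, γ.1.2 i), γ.2 i) (w i)) :
    IsDifferential (Γ := Γ ▹ .arr n ▹ .arr n) (A := .arr n)
      (fun x i => f ((x.1.1, x.1.2 i), x.2 i)) γ
      (fun z c' =>
        (Γ.dot (foldArr Γ.addV Γ.zeroV n fun i => Γ.smulV (z i) (w i).1.1) c'.1.1 +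
          (STy.arr n).dot (fun i => @HMul.hMul ℝ ℝ ℝ _ (w i).1.2 (z i)) c'.1.2) +
        (STy.arr n).dot (fun i => @HMul.hMul ℝ ℝ ℝ _ (w i).2 (z i)) c'.2) := by
  intro c c' h0 hc
  subst h0
  refine ⟨fun i => SCtx.dot (Γ ▹ .real ▹ .real) (w i) ((c'.1.1, c'.1.2 i), c'.2 i),
    fun i => hw i (fun t => (((c t).1.1, (c t).1.2 i), (c t).2 i)) ((c'.1.1, c'.1.2 i), c'.2 i) rfl
      ⟨⟨hc.1.1, hc.1.2 i⟩, hc.2 i⟩, fun z => ?_⟩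
  have key : ∀ p q a q' b z : Fin n → ℝ,
      (∑ i, z i * p i + ∑ i, q i * z i * a i) + ∑ i, q' i * z i * b i =
        ∑ i, z i * (p i + q i * a i + q' i * b i) := by
    intro p q a q' b z
    rw [← Finset.sum_add_distrib, ← Finset.sum_add_distrib]
    exact Finset.sum_congr rfl fun i _ => by ring
  refine Eq.trans ?_ (key (fun i => Γ.dot (w i).1.1 c'.1.1) (fun i => (w i).1.2) c'.1.2
    (fun i => (w i).2) c'.2 z)
  have h : Γ.dot (foldArr Γ.addV Γ.zeroV n fun i => Γ.smulV (z i) (w i).1.1) c'.1.1 =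
      ∑ i : Fin n, @HMul.hMul ℝ ℝ ℝ _ (z i) (Γ.dot (w i).1.1 c'.1.1) :=
    (SCtx.dot_foldArr _ _ _).trans (Finset.sum_congr rfl fun i _ => SCtx.dot_smulV Γ _ _ _)
  exact congrArg (fun x : ℝ => x + _ + _) h

/-- The initial value is frozen at `u`, so only the array varies. Gradients are assumed at all
points of the plane because they are used at the intermediate accumulators. -/
theorem isDifferential_reduce {n : ℕ} {f : TCtx.Env (SCtx.emb (.nil ▹ .real ▹ .real)) → ℝ}
    {w : ℝ → ℝ → TCtx.Env (SCtx.emb (.nil ▹ .real ▹ .real))}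
    (hw : ∀ a b : ℝ, IsGrad (Γ := .nil ▹ .real ▹ .real) f ((PUnit.unit, a), b) (w a b)) (u : ℝ)
    (γ : TCtx.Env (SCtx.emb (Γ ▹ .arr n))) (v : Fin n → ℝ) (hv : γ.2 = v) :
    IsDifferential (Γ := Γ ▹ .arr n) (A := .real)
      (fun x => foldArr (fun a b : ℝ => f ((PUnit.unit, a), b)) u n x.2) γ
      (fun z c' => (STy.arr n).dot (fun i => @HMul.hMul ℝ ℝ ℝ _ (@HMul.hMul ℝ ℝ ℝ _
        (w (foldPrefix (fun a b : ℝ => f ((PUnit.unit, a), b)) u v i) (v i)).2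
        (∏ k, if i < k then
          (w (foldPrefix (fun a b : ℝ => f ((PUnit.unit, a), b)) u v k) (v k)).1.2 else 1)) z)
        c'.2) := by
  intro c c' h0 hc
  subst h0 hv
  have hm : ∀ (a b : ℝ → ℝ) (a' b' : ℝ), HasDerivAt a a' 0 → HasDerivAt b b' 0 →
      HasDerivAt (fun t => f ((PUnit.unit, a t), b t))
        (@HMul.hMul ℝ ℝ ℝ _ (w (a 0) (b 0)).1.2 a' + @HMul.hMul ℝ ℝ ℝ _ (w (a 0) (b 0)).2 b') 0 := by
    intro a b a' b' ha hb
    have h := hw (a 0) (b 0) (fun t => ((PUnit.unit, a t), b t)) ((PUnit.unit, a'), b') rfl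
      ⟨⟨trivial, ha⟩, hb⟩
    exact h.congr_deriv (congrArg (· + _) (zero_add _))
  refine ⟨_, hasDerivAt_foldArr (p := fun a b => (w a b).1.2) (q := fun a b => (w a b).2) hm u n
    (fun t => (c t).2) c'.2 hc.2, fun z => ?_⟩
  have key : ∀ (p a : Fin n → ℝ) (z : ℝ), ∑ i, p i * z * a i = z * ∑ i, p i * a i := by
    intro p a z
    rw [Finset.mul_sum]
    exact Finset.sum_congr rfl fun i _ => by ring
  exact key _ c'.2 z

end Differentials

/-! ### Correctness of the direct reverse-mode transformation -/

namespace Tm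

variable {S : Signature.{u}} {Δ : TCtx} {A B ρ : Ty}

/-- In the environment `δ` the term `t` computes the value `a` and the continuation `k`. -/
def Computes (t : Tm S Δ (.prod A (.fn B ρ))) (δ : TCtx.Env Δ) (a : A.den) (k : B.den → ρ.den) :
    Prop :=
  (t.den δ).1 = a ∧ ∀ x, SmoothMap.toFun (t.den δ).2 x = k x

/-- The body sees an arbitrary `Y` with the prescribed values, so later steps depend on the first
continuation only through its behaviour. -/
theorem Computes.letPair {A' B' ρ' : Ty} {t : Tm S Δ (.prod A (.fn B ρ))} {δ : TCtx.Env Δ}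
    {a : A.den} {k : B.den → ρ.den} (h : t.Computes δ a k)
    {b : Tm S (Δ ▹ .prod A (.fn B ρ) ▹ A ▹ .fn B ρ) (.prod A' (.fn B' ρ'))}
    {a' : A'.den} {k' : B'.den → ρ'.den}
    (hb : ∀ Y : (Ty.fn B ρ).den, (∀ x, SmoothMap.toFun Y x = k x) →
      b.Computes (((δ, (a, Y)), a), Y) a' k') :
    (Tm.letPair t b).Computes δ a' k' := by
  obtain ⟨rfl, h₂⟩ := h
  exact hb _ h₂

theorem Computes.let_ {C : Ty} {t : Tm S Δ C} {δ : TCtx.Env Δ} {c : C.den} (ht : t.den δ = c)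
    {b : Tm S (Δ ▹ C) (.prod A (.fn B ρ))} {a : A.den} {k : B.den → ρ.den}
    (hb : b.Computes (δ, c) a k) : (Tm.let_ t b).Computes δ a k := by
  subst ht
  exact hb

theorem Computes.pair_backFun {Γ : SCtx} {A : STy} {R : Ty} {t : Tm S Δ A.emb} {δ : TCtx.Env Δ}
    {a : A.emb.den} {Y : Var Δ (.fn R ρ)} {args : Tm S (Δ.append Γ.emb ▹ A.emb) R}
    {k : TCtx.Env (SCtx.emb (Γ ▹ A)) → ρ.den} (ht : t.den δ = a)
    (hk : ∀ x : TCtx.Env (SCtx.emb (Γ ▹ A)),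
      SmoothMap.toFun (Y.val δ) (args.den (appendEnv Γ.emb δ x.1, x.2)) = k x) :
    (pair t (backFun Γ A Y args)).Computes δ a k :=
  ⟨ht, fun x => (den_backFun rfl).trans (hk x)⟩

theorem den_rename_back {Γ : SCtx} (t : Tm S Δ A) (δ : TCtx.Env Δ) (x : TCtx.Env Γ.emb)
    (b : B.den) : (t.rename (Ren.back Γ B)).den (appendEnv Γ.emb δ x, b) = t.den δ :=
  t.den_rename (Ren.sel_back δ x b)

theorem den_reduceBack_back {Γ : SCtx} {n : ℕ} {p : Tm S Δ (.prod (.arr .real n) (.arr .real n))}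
    (δ : TCtx.Env Δ) (x : TCtx.Env (SCtx.emb (Γ ▹ .real))) {a b : Fin n → ℝ}
    (hp : p.den δ = (a, b)) :
    (pair (pair (backVars Γ STy.real.emb) (zero .real))
      (reduceBack (p.rename (Ren.back Γ STy.real.emb)) v0)).den (appendEnv Γ.emb δ x.1, x.2) =
      ((x.1, (0 : ℝ)), fun i => @HMul.hMul ℝ ℝ ℝ _ (a i * b i) x.2) :=
  Prod.ext (Prod.ext (den_backVars δ x.1 x.2) rfl)
    (den_reduceBack (z := v0) (r := x.2) ((den_rename_back p δ x.1 x.2).trans hp) rfl)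

end Tm

theorem Ren.sel_letPair {Δ : TCtx} {A B : Ty} (δ : TCtx.Env Δ) (a : A.den) (b : B.den) :
    (Ren.wk₃ (Δ := Δ) (A := .prod A B) (B := A) (C := B)).Sel δ (((δ, (a, b)), a), b) :=
  fun _ _ => rfl

namespace Src

variable {S : Signature.{u}}

/-- Two two-sided units `u`, `u'` of one operation `m` agree, since both equal `m u u'`. The
operation is closed, hence the same for `γ` and `γ'`. -/
theorem ReduceOK.den_unit {Γ : SCtx} {n : ℕ} {e₁ : Src S (.nil ▹ .real ▹ .real) .real}
    {e₂ : Src S Γ .real} {e₃ : Src S Γ (.arr n)} (h : (reduce e₁ e₂ e₃).ReduceOK)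
    (γ γ' : TCtx.Env Γ.emb) : e₂.den γ = e₂.den γ' :=
  ((h.1.2 γ' (e₂.den γ)).2.symm).trans (h.1.2 γ (e₂.den γ')).1

/-- `G` is the transposed derivative of `⟨Id, ⟦e⟧⟩` at `γ`, for `e` placed in the context `Γ'` along
`s`, and the direct transformation of `e` computes the value of `e` and the composition of the
continuation with `G`. -/
def DirectSpec {Γ : SCtx} {A : STy} (e : Src S Γ A) {Γ' : SCtx} (s : Ren Γ Γ')
    (γ : TCtx.Env Γ'.emb) (G : TCtx.Env (SCtx.emb (Γ' ▹ A)) → TCtx.Env Γ'.emb) : Prop :=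
  IsVJP (Δ := Γ' ▹ A) (fun x => (x, e.den (SCtx.pull s x))) γ G ∧
    ∀ {Δ : TCtx} {ρ : Ty} (v : SRen Γ' Δ) (Y : Var Δ (.fn (tup Γ'.emb) ρ)) (δ : TCtx.Env Δ),
      v.Sel γ δ → (e.direct s v Y).Computes δ (e.den (SCtx.pull s γ))
        (fun x => SmoothMap.toFun (Y.val δ) (G x))

theorem DirectSpec.den_runGrad {Γ : SCtx} {e : Src S Γ .real} {Γ' : SCtx} {s : Ren Γ Γ'}
    {γ : TCtx.Env Γ'.emb} {G : TCtx.Env (SCtx.emb (Γ' ▹ .real)) → TCtx.Env Γ'.emb}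
    (h : e.DirectSpec s γ G) {Δ : TCtx} {v : SRen Γ' Δ} {δ : TCtx.Env Δ} (hv : v.Sel γ δ) :
    (Tm.runGrad Γ' (e.direct s v.wk .zero)).den δ = G (SCtx.zeroV Γ', (1 : ℝ)) :=
  Tm.den_runGrad fun Y => (h.2 v.wk .zero (δ, Y) (hv.wk (B := .fn (tup Γ'.emb) (tup Γ'.emb)) Y)).2

/-- The placement `s` into a larger `Γ'` is universally quantified because a second argument is
transformed in the context extended by the first value. `G` is chosen before the target context, the
continuation and the assignment of variables, so the same `G` is usable wherever the transformed
term is placed. -/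
theorem exists_directSpec {Γ : SCtx} {A : STy} (e : Src S Γ A) (he : e.ReduceOK) :
    ∀ {Γ' : SCtx} (s : Ren Γ Γ') (γ : TCtx.Env Γ'.emb), ∃ G, e.DirectSpec s γ G := by
  induction e with
  | @var Γ A i =>
    intro Γ' s γ
    refine ⟨fun z => SCtx.addV Γ' z.1 (SCtx.hotV (s i) z.2),
      ((isDifferential_get (s i) γ).isVJP (r := fun x => x) (fun _ _ h => h) fun z c' => ?_).congr
        fun x => Prod.ext rfl (SCtx.get_pull s i x).symm, fun v Y δ hv => ?_⟩
    · exact (SCtx.dot_addV _ _ _ _).trans (congrArg (_ + ·) (SCtx.dot_hotV _ _ _))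
    · exact .pair_backFun ((hv (s i)).trans (SCtx.get_pull s i γ).symm) fun x =>
        congrArg (SmoothMap.toFun (Y.val δ)) ((Tm.den_addC _ _ _ _).trans
          (congrArg₂ (SCtx.addV Γ') (Tm.den_backVars δ x.1 x.2) (Tm.den_hot _ _ _)))
  | cst c =>
    intro Γ' s γ
    refine ⟨fun z => z.1,
      (isDifferential_const c γ).isVJP (r := fun x => x) (fun _ _ h => h) fun z c' => ?_,
      fun v Y δ hv => ?_⟩
    · exact (add_zero _).symm
    · refine .pair_backFun (A := .real) ?_ fun x => ?_
      · rfl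
      · exact congrArg (SmoothMap.toFun (Y.val δ)) (Tm.den_backVars δ x.1 x.2)
  | @let_ Γ A B e₁ e₂ ih₁ ih₂ =>
    intro Γ' s γ
    obtain ⟨G₁, hG₁, h₁⟩ := ih₁ he.1 s γ
    obtain ⟨G₂, hG₂, h₂⟩ := ih₂ he.2 (s.lift (B := A)) (γ, e₁.den (SCtx.pull s γ))
    -- The last step forgets the bound value; its transpose puts a zero cotangent there.
    have hP := (isDifferential_get (.zero : Var (Γ' ▹ A ▹ B) B) ((γ, e₁.den (SCtx.pull s γ)),
      e₂.den (SCtx.pull s.lift (γ, e₁.den (SCtx.pull s γ))))).isVJP (Θ := Γ') (r := fun x => x.1.1)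
      (fun _ _ h => h.1.1) (G := fun z => ((z.1, A.zeroV), z.2)) fun z c' =>
        congrArg (· + B.dot z.2 c'.2) ((congrArg (_ + ·) (A.dot_zeroV c'.1.2)).trans (add_zero _))
    refine ⟨_, ((hP.comp hG₂).comp hG₁).congr fun x =>
      Prod.ext rfl (congrArg e₂.den (SCtx.pull_lift s x _)), fun v Y δ hv => ?_⟩
    refine (h₁ v Y δ hv).letPair fun Z hZ => (h₂ _ .zero _ ((hv.andThen (Ren.sel_letPair δ _ _)).cons
      rfl)).letPair fun Z' hZ' => ?_
    refine .pair_backFun ?_ fun x => ?_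
    · exact (congrArg e₂.den (SCtx.pull_lift s γ _))
    refine (congrArg (SmoothMap.toFun Z') ?_).trans ((hZ' _).trans (hZ _))
    exact Prod.ext (Prod.ext (Tm.den_backVars _ x.1 x.2) (Tm.den_zero _ A)) rfl
  | @pair Γ A B e₁ e₂ ih₁ ih₂ =>
    intro Γ' s γ
    obtain ⟨G₁, hG₁, h₁⟩ := ih₁ he.1 s γ
    obtain ⟨G₂, hG₂, h₂⟩ := ih₂ he.2 (s.wk (B := A)) (γ, e₁.den (SCtx.pull s γ))
    have hP := (isDifferential_pair (Γ := Γ') (A := A) (B := B) ((γ, e₁.den (SCtx.pull s γ)),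
      e₂.den (SCtx.pull s.wk (γ, e₁.den (SCtx.pull s γ))))).isVJP (Θ := Γ') (r := fun x => x.1.1)
      (fun _ _ h => h.1.1) (G := fun z => ((z.1, z.2.1), z.2.2)) fun z c' => add_assoc _ _ _
    refine ⟨_, ((hP.comp hG₂).comp hG₁).congr fun x =>
      Prod.ext rfl (Prod.ext rfl (congrArg e₂.den (SCtx.pull_wk s x _))), fun v Y δ hv => ?_⟩
    refine (h₁ v Y δ hv).letPair fun Z hZ => (h₂ _ .zero _ ((hv.andThen (Ren.sel_letPair δ _ _)).cons
      rfl)).letPair fun Z' hZ' => ?_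
    refine .pair_backFun (A := .prod A B) ?_ fun x => ?_
    · exact (Prod.ext rfl (congrArg e₂.den (SCtx.pull_wk s γ _)))
    refine (congrArg (SmoothMap.toFun Z') ?_).trans ((hZ' _).trans (hZ _))
    exact Prod.ext (Prod.ext (Tm.den_backVars _ x.1 x.2) rfl) rfl
  | @fst Γ A B e ih =>
    intro Γ' s γ
    obtain ⟨G, hG, h⟩ := ih he s γ
    have hP := (isDifferential_fst (Γ := Γ') (A := A) (B := B) (γ, e.den (SCtx.pull s γ))).isVJP
      (Θ := Γ') (r := fun x => x.1) (fun _ _ h => h.1) (G := fun z => (z.1, (z.2, B.zeroV)))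
      fun z c' => congrArg (_ + ·) ((congrArg (_ + ·) (B.dot_zeroV _)).trans (add_zero _))
    refine ⟨_, hP.comp hG, fun v Y δ hv => (h v Y δ hv).letPair fun Z hZ =>
      .pair_backFun ?_ fun x => ?_⟩
    · rfl
    refine (congrArg (SmoothMap.toFun Z) ?_).trans (hZ _)
    exact Prod.ext (Tm.den_backVars _ x.1 x.2) (Prod.ext rfl (Tm.den_zero _ B))
  | @snd Γ A B e ih =>
    intro Γ' s γ
    obtain ⟨G, hG, h⟩ := ih he s γ
    have hP := (isDifferential_snd (Γ := Γ') (A := A) (B := B) (γ, e.den (SCtx.pull s γ))).isVJP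
      (Θ := Γ') (r := fun x => x.1) (fun _ _ h => h.1) (G := fun z => (z.1, (A.zeroV, z.2)))
      fun z c' => congrArg (_ + ·) ((congrArg (· + _) (A.dot_zeroV _)).trans (zero_add _))
    refine ⟨_, hP.comp hG, fun v Y δ hv => (h v Y δ hv).letPair fun Z hZ =>
      .pair_backFun ?_ fun x => ?_⟩
    · rfl
    refine (congrArg (SmoothMap.toFun Z) ?_).trans (hZ _)
    exact Prod.ext (Tm.den_backVars _ x.1 x.2) (Prod.ext (Tm.den_zero _ A) rfl)
  | @op1 Γ f e ih =>
    intro Γ' s γ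
    obtain ⟨G, hG, h⟩ := ih he s γ
    have hP := (isDifferential_op1 (Γ := Γ') f (γ, e.den (SCtx.pull s γ))).isVJP
      (Θ := Γ') (r := fun x => x.1) (fun _ _ h => h.1)
      (G := fun z => (z.1, @HMul.hMul ℝ ℝ ℝ _ (S.den1 (S.d f) (e.den (SCtx.pull s γ))) z.2))
      fun z c' => rfl
    refine ⟨_, hP.comp hG, fun v Y δ hv => (h v Y δ hv).letPair fun Z hZ =>
      .pair_backFun (A := .real) ?_ fun x => ?_⟩
    · rfl
    refine (congrArg (SmoothMap.toFun Z) ?_).trans (hZ _)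
    refine Prod.ext (Tm.den_backVars _ x.1 x.2) ((S.den_mul _ _).trans ?_)
    exact congrArg (fun y => @HMul.hMul ℝ ℝ ℝ _ (S.den1 (S.d f) y) x.2)
      (Tm.den_rename_back Tm.v1 _ x.1 x.2)
  | @op2 Γ g e₁ e₂ ih₁ ih₂ =>
    intro Γ' s γ
    obtain ⟨G₁, hG₁, h₁⟩ := ih₁ he.1 s γ
    obtain ⟨G₂, hG₂, h₂⟩ := ih₂ he.2 (s.wk (B := .real)) (γ, e₁.den (SCtx.pull s γ))
    set a := e₁.den (SCtx.pull s γ) with ha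
    set b := e₂.den (SCtx.pull s.wk (γ, a)) with hb
    have hP := (isDifferential_op2 (Γ := Γ') g ((γ, a), b)).isVJP (Θ := Γ') (r := fun x => x.1.1)
      (fun _ _ h => h.1.1) (G := fun z => ((z.1, @HMul.hMul ℝ ℝ ℝ _ (S.den2 (S.d₁ g) a b) z.2),
        @HMul.hMul ℝ ℝ ℝ _ (S.den2 (S.d₂ g) a b) z.2)) fun z c' => add_assoc _ _ _
    refine ⟨_, ((hP.comp hG₂).comp hG₁).congr fun x =>
      Prod.ext rfl (congrArg (S.den2 g _) (congrArg e₂.den (SCtx.pull_wk s x _))),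
      fun v Y δ hv => ?_⟩
    refine (h₁ v Y δ hv).letPair fun Z hZ => (h₂ _ .zero _ ((hv.andThen (Ren.sel_letPair δ _ _)).cons
      rfl)).letPair fun Z' hZ' => ?_
    refine .pair_backFun (A := .real) ?_ fun x => ?_
    · exact (congrArg (S.den2 g _) (congrArg e₂.den (SCtx.pull_wk s γ _)))
    refine (congrArg (SmoothMap.toFun Z') ?_).trans ((hZ' _).trans (hZ _))
    exact Prod.ext (Prod.ext (Tm.den_backVars _ x.1 x.2) ((S.den_mul _ _).trans
      (congrArg₂ (fun y y' => @HMul.hMul ℝ ℝ ℝ _ (S.den2 (S.d₁ g) y y') x.2)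
        (Tm.den_rename_back Tm.v4 _ x.1 x.2) (Tm.den_rename_back Tm.v1 _ x.1 x.2))))
      ((S.den_mul _ _).trans
      (congrArg₂ (fun y y' => @HMul.hMul ℝ ℝ ℝ _ (S.den2 (S.d₂ g) y y') x.2)
        (Tm.den_rename_back Tm.v4 _ x.1 x.2) (Tm.den_rename_back Tm.v1 _ x.1 x.2)))
  | @map2 Γ n e₁ e₂ e₃ ih₁ ih₂ ih₃ =>
    intro Γ' s γ
    obtain ⟨G₂, hG₂, h₂⟩ := ih₂ he.2.1 s γ
    obtain ⟨G₃, hG₃, h₃⟩ := ih₃ he.2.2 (s.wk (B := .arr n)) (γ, e₂.den (SCtx.pull s γ))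
    set a := e₂.den (SCtx.pull s γ) with ha
    set b := e₃.den (SCtx.pull s.wk (γ, a)) with hb
    -- Only the `n` points at which `map2` evaluates its function are needed.
    choose G₁ h₁ using fun i : Fin n =>
      ih₁ he.1 (s.lift (B := .real)).lift (Γ' := Γ' ▹ .real ▹ .real) ((γ, a i), b i)
    let w := fun i => G₁ i (SCtx.zeroV (Γ' ▹ .real ▹ .real), (1 : ℝ))
    -- The intermediate arrays are not returned, so the incoming cotangent is added only in the `Γ'`
    -- slot.
    have key : ∀ {t p f : ℝ} (q r : ℝ), t = p + f → t + q + r = p + (f + q + r) :=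
      fun q r h => by rw [h]; ring
    have hP := (isDifferential_map2 (γ := ((γ, a), b)) fun i => (h₁ i).1.isGrad).isVJP (Θ := Γ')
      (r := fun x => x.1.1) (fun _ _ h => h.1.1) (G := fun z =>
        ((SCtx.addV Γ' z.1
          (foldArr Γ'.addV Γ'.zeroV n fun i => Γ'.smulV (z.2 i) (w i).1.1),
          fun i => @HMul.hMul ℝ ℝ ℝ _ (w i).1.2 (z.2 i)),
          fun i => @HMul.hMul ℝ ℝ ℝ _ (w i).2 (z.2 i)))
      fun z c' => key _ _ (SCtx.dot_addV Γ' z.1 _ c'.1.1)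
    refine ⟨_, ((hP.comp hG₃).comp hG₂).congr fun x => Prod.ext rfl (funext fun i =>
      congrArg e₁.den ((SCtx.pull_lift₂ s x _ _).trans (congrArg (Prod.mk _)
        (congrArg (fun y => e₃.den y i) (SCtx.pull_wk s x _))))), fun {Δ ρ} v Y δ hv => ?_⟩
    refine (h₂ v Y δ hv).letPair fun Z hZ => (h₃ _ .zero _ ((hv.andThen (Ren.sel_letPair δ _ _)).cons
      rfl)).letPair fun Z' hZ' => ?_
    have hv' := (hv.andThen (Ren.sel_letPair (A := .arr .real n)
      (B := .fn (tup (SCtx.emb (Γ' ▹ .arr n))) ρ) δ a Z)).andThen (Ren.sel_letPair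
        (A := .arr .real n) (B := .fn (tup (SCtx.emb (Γ' ▹ .arr n ▹ .arr n))) ρ) _ b Z')
    refine .pair_backFun (A := .arr n) ?_ fun x => ?_
    · refine funext fun i => (e₁.den_toTm (((hv'.precomp s).lift (B := .real) (a i)).lift
        (B := .real) (b i))).trans ?_
      exact congrArg (fun y => e₁.den ((SCtx.pull s γ, a i), e₃.den y i)) (SCtx.pull_wk s γ _)
    refine (congrArg (SmoothMap.toFun Z') ?_).trans ((hZ' _).trans (hZ _))
    have hg := fun i => (h₁ i).den_runGrad (((hv'.andThen (Ren.sel_back _ x.1 x.2)).lift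
      (B := .real) (a i)).lift (B := .real) (b i))
    exact Prod.ext (Prod.ext ((Tm.den_addC _ _ _ _).trans (congrArg₂ (SCtx.addV Γ')
      (Tm.den_backVars _ x.1 x.2) (Tm.den_map2BackΓ (A := Tm.v4.rename (Ren.back Γ' _)) (B := Tm.v1.rename (Ren.back Γ' _))
        (Z := Tm.v0) (a := a) (b := b) (z := x.2)
        (Tm.den_rename_back Tm.v4 _ x.1 x.2) (Tm.den_rename_back Tm.v1 _ x.1 x.2) rfl hg)))
      (Tm.den_map2Back₁ (A := Tm.v4.rename (Ren.back Γ' _)) (B := Tm.v1.rename (Ren.back Γ' _))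
        (Z := Tm.v0) (a := a) (b := b) (z := x.2)
        (Tm.den_rename_back Tm.v4 _ x.1 x.2) (Tm.den_rename_back Tm.v1 _ x.1 x.2) rfl hg)) (Tm.den_map2Back₂ (A := Tm.v4.rename (Ren.back Γ' _)) (B := Tm.v1.rename (Ren.back Γ' _))
        (Z := Tm.v0) (a := a) (b := b) (z := x.2)
        (Tm.den_rename_back Tm.v4 _ x.1 x.2) (Tm.den_rename_back Tm.v1 _ x.1 x.2) rfl hg)
  | @reduce Γ n e₁ e₂ e₃ ih₁ ih₂ ih₃ =>
    intro Γ' s γ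
    obtain ⟨G₂, hG₂, h₂⟩ := ih₂ he.2.2.1 s γ
    obtain ⟨G₃, hG₃, h₃⟩ := ih₃ he.2.2.2 (s.wk (B := .real)) (γ, e₂.den (SCtx.pull s γ))
    set u := e₂.den (SCtx.pull s γ) with hu
    set b := e₃.den (SCtx.pull s.wk (γ, u)) with hb
    choose G₁ h₁ using fun x y : ℝ => ih₁ he.2.1 (Ren.id _) ((PUnit.unit, x), y)
    let m : ℝ → ℝ → ℝ := fun x y => e₁.den (SCtx.pull (Ren.id _) ((PUnit.unit, x), y))
    let w := fun x y : ℝ => G₁ x y (SCtx.zeroV (.nil ▹ .real ▹ .real), (1 : ℝ))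
    -- The slot of the initial value receives the cotangent 0, the fold being differentiated with
    -- that value fixed at `u`.
    have hP := (isDifferential_reduce (Γ := Γ' ▹ .real) (f := fun x => e₁.den (SCtx.pull (Ren.id _) x))
      (fun x y => (h₁ x y).1.isGrad) u ((γ, u), b) b rfl).isVJP (Θ := Γ') (r := fun x => x.1.1)
      (fun _ _ h => h.1.1) (G := fun z => ((z.1, (0 : ℝ)), _)) fun z c' =>
      congrArg (· + _) ((congrArg (_ + ·) (zero_mul (M₀ := ℝ) _)).trans (add_zero _))
    -- Fixing the initial value changes nothing: at any `x` it is a unit of the same operation,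
    -- hence equal to `u`.
    refine ⟨_, ((hP.comp hG₃).comp hG₂).congr fun x => Prod.ext rfl (foldArr_congr
      (fun _ _ => congrArg e₁.den (SCtx.pull_id _)) (he.den_unit _ _)
      (fun i => congrArg (fun y => e₃.den y i) (SCtx.pull_wk s x _))), fun v Y δ hv => ?_⟩
    refine (h₂ v Y δ hv).letPair fun Z hZ => (h₃ _ .zero _ ((hv.andThen (Ren.sel_letPair δ _ _)).cons
      rfl)).letPair fun Z' hZ' => ?_
    have hE := fun (Δ : TCtx) (δ : TCtx.Env Δ) (x y : ℝ) =>
      ((SRen.sel_empty δ).lift (B := .real) x).lift (B := .real) y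
    refine .let_ (Tm.den_reduceTape (u := u) (v := b) (m := m) (w := w)
      (fun x y => (e₁.den_toTm (hE _ _ x y)).trans
        (congrArg e₁.den (SCtx.pull_id (Γ := .nil ▹ .real ▹ .real) _).symm))
      (fun x y => (h₁ x y).den_runGrad (hE _ _ x y)) rfl rfl) ?_
    refine .pair_backFun (A := .real) ?_ fun x => ?_
    · exact foldArr_congr (fun x y => e₁.den_toTm (hE _ _ x y)) rfl
        fun i => congrArg (fun y => e₃.den y i) (SCtx.pull_wk s γ _)
    refine (congrArg (SmoothMap.toFun Z') ?_).trans ((hZ' _).trans (hZ _))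
    exact Tm.den_reduceBack_back (p := Tm.v0) _ x rfl

end Src

/-! ### Values of compound terms from values of their parts. -/

namespace Tm

variable {S : Signature.{u}} {Δ : TCtx} {δ : TCtx.Env Δ}

theorem den_pair {A B : Ty} {t : Tm S Δ A} {s : Tm S Δ B} {a : A.den} {b : B.den}
    (ht : t.den δ = a) (hs : s.den δ = b) : (pair t s).den δ = (a, b) :=
  Prod.ext ht hs

theorem den_var {Γ : SCtx} {v : SRen Γ Δ} {γ : TCtx.Env Γ.emb} (hv : v.Sel γ δ) {A : STy}
    (i : Var Γ A) : (var (S := S) (v i)).den δ = i.get γ :=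
  hv i

theorem den_add_of_eq {A : STy} {t s : Tm S Δ A.emb} {a b : A.emb.den} (ht : t.den δ = a)
    (hs : s.den δ = b) : (add A t s).den δ = A.addV a b :=
  (den_add δ A t s).trans (congrArg₂ A.addV ht hs)

theorem den_addC_of_eq {Γ : SCtx} {t s : Tm S Δ (tup Γ.emb)} {a b : TCtx.Env Γ.emb}
    (ht : t.den δ = a) (hs : s.den δ = b) : (addC Γ t s).den δ = Γ.addV a b :=
  (den_addC δ Γ t s).trans (congrArg₂ Γ.addV ht hs)

end Tm

/-! ### Primitives of unary normal forms -/

namespace Prim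

variable {S : Signature.{u}}

/-- Denotation of the primitives. -/
def den {Γ Γ' : SCtx} : Prim S Γ Γ' → TCtx.Env Γ.emb → TCtx.Env Γ'.emb
  | var i => fun γ => (γ, i.get γ)
  | cst c => fun γ => (γ, c)
  | op1 f => fun γ => (γ, S.den1 f γ.2)
  | op2 g => fun γ => (γ, S.den2 g γ.1.2 γ.2)
  | fst => fun γ => (γ, γ.2.1)
  | snd => fun γ => (γ, γ.2.2)
  | pair => fun γ => (γ.1.1, (γ.1.2, γ.2))
  | map2 e => fun γ => (γ, fun i => e.den ((γ.1.1, γ.1.2 i), γ.2 i))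
  | reduce (n := n) e₁ e₂ => fun γ =>
    (γ, foldArr (fun a b : ℝ => e₁.den ((PUnit.unit, a), b)) (e₂.den γ.1) n γ.2)
  | proj Θ => fun γ => (SCtx.dropV Θ γ.1, γ.2)

/-- The assumption on `reduce` for the primitives: the initial value of a `reduce` is constant. -/
def ReduceOK {Γ Γ' : SCtx} : Prim S Γ Γ' → Prop
  | map2 e => e.ReduceOK
  | reduce e₁ e₂ => e₁.ReduceOK ∧ ∀ γ γ', e₂.den γ = e₂.den γ'
  | _ => True

theorem den_toTm {Γ Γ' : SCtx} (p : Prim S Γ Γ') {Δ : TCtx} {v : SRen Γ Δ} {γ : TCtx.Env Γ.emb}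
    {δ : TCtx.Env Δ} (hv : v.Sel γ δ) : (p.toTm v).den δ = p.den γ := by
  cases p with
  | var i => exact Tm.den_pair (Tm.den_vars hv) (hv i)
  | cst c => exact Tm.den_pair (Tm.den_vars hv) rfl
  | op1 f => exact Tm.den_pair (Tm.den_vars hv) (congrArg (S.den1 f) (hv .zero))
  | op2 g =>
    exact Tm.den_pair (Tm.den_vars hv) (congrArg₂ (S.den2 g) (hv (.succ .zero)) (hv .zero))
  | fst => exact Tm.den_pair (Tm.den_vars hv) (congrArg Prod.fst (Tm.den_var hv .zero))
  | snd => exact Tm.den_pair (Tm.den_vars hv) (congrArg Prod.snd (Tm.den_var hv .zero))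
  | pair =>
    exact Tm.den_pair (Tm.den_vars fun _ i => hv (.succ (.succ i)))
      (Tm.den_pair (Tm.den_var hv (.succ .zero)) (Tm.den_var hv .zero))
  | @map2 Γ n e =>
    have h : (v.precomp (Ren.id Γ).wk.wk).Sel γ.1.1 δ := fun _ i => hv (.succ (.succ i))
    refine Tm.den_pair (Tm.den_vars hv) (funext fun i =>
      (e.den_toTm ((h.lift (B := .real) _).lift (B := .real) _)).trans ?_)
    exact congrArg₂ (fun a b : Fin n → ℝ => e.den ((γ.1.1, a i), b i)) (hv (.succ .zero)) (hv .zero)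
  | @reduce Γ n e₁ e₂ =>
    have h : (v.precomp (Ren.id Γ).wk).Sel γ.1 δ := fun _ i => hv (.succ i)
    exact Tm.den_pair (Tm.den_vars hv) (foldArr_congr (fun x y => e₁.den_toTm
      (((SRen.sel_empty δ).lift (B := .real) x).lift (B := .real) y)) (e₂.den_toTm h)
      fun i => congrFun (hv .zero) i)
  | proj Θ => exact Tm.den_pair (Tm.den_vars (SRen.Sel.dropV Θ hv)) (hv .zero)

/-- `G` is the transposed derivative of the primitive `p` at `γ`, and `J^T p` computes it. -/
def JacSpec {Γ Γ' : SCtx} (p : Prim S Γ Γ') (γ : TCtx.Env Γ.emb)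
    (G : TCtx.Env Γ'.emb → TCtx.Env Γ.emb) : Prop :=
  IsVJP p.den γ G ∧ ∀ {Δ : TCtx} {v : SRen Γ Δ} {y : SRen Γ' Δ} {δ : TCtx.Env Δ}
    (x : TCtx.Env Γ'.emb), v.Sel γ δ → y.Sel x δ → (p.jacTm v y).den δ = G x

/-- Apart from `pair` and `proj`, a primitive returns its arguments as well, so `r` is the identity
and each argument receives its incoming cotangent plus the contribution through the new value. -/
theorem exists_jacSpec {Γ Γ' : SCtx} (p : Prim S Γ Γ') (hp : p.ReduceOK) (γ : TCtx.Env Γ.emb) :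
    ∃ G, p.JacSpec γ G := by
  have hid : ∀ (Γ : SCtx) (c : ℝ → TCtx.Env Γ.emb) (c' : TCtx.Env Γ.emb), Γ.HasVel c c' →
    Γ.HasVel (fun t => (fun x => x) (c t)) ((fun x => x) c') := fun _ _ _ h => h
  cases p with
  | var i =>
    refine ⟨fun z => SCtx.addV Γ z.1 (SCtx.hotV i z.2),
      (isDifferential_get i γ).isVJP (hid _) fun z c' => ?_, fun {Δ v y δ} x hv hy => ?_⟩
    · exact (SCtx.dot_addV _ _ _ _).trans (congrArg (_ + ·) (SCtx.dot_hotV _ _ _))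
    · exact Tm.den_addC_of_eq (Tm.den_vars fun _ j => hy (.succ j))
        ((Tm.den_hot _ _ _).trans (congrArg (SCtx.hotV i) (Tm.den_var hy .zero)))
  | cst c =>
    refine ⟨fun z => z.1, (isDifferential_const c γ).isVJP (hid _) fun z c' => ?_,
      fun {Δ v y δ} x hv hy => ?_⟩
    · exact (add_zero _).symm
    · exact Tm.den_vars fun _ j => hy (.succ j)
  | @op1 Γ f =>
    have key : ∀ p a m z c : ℝ, p + (a + m * z) * c = p + a * c + m * z * c :=
      fun p a m z c => by ring
    refine ⟨fun z => (z.1.1, @HAdd.hAdd ℝ ℝ ℝ _ z.1.2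
      (@HMul.hMul ℝ ℝ ℝ _ (S.den1 (S.d f) γ.2) z.2)),
      (isDifferential_op1 f γ).isVJP (hid _) fun z c' => key _ z.1.2 _ z.2 c'.2,
      fun {Δ v y δ} x hv hy => ?_⟩
    refine Tm.den_pair (Tm.den_vars fun _ j => hy (.succ (.succ j))) ((S.den_add _ _).trans ?_)
    refine congrArg₂ (fun a b : ℝ => a + b) (hy (.succ .zero)) ((S.den_mul _ _).trans ?_)
    exact congrArg₂ (fun a b : ℝ => S.den1 (S.d f) a * b) (hv .zero) (hy .zero)
  | @op2 Γ g =>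
    have key : ∀ p a b m n z c d : ℝ, p + (a + m * z) * c + (b + n * z) * d =
      p + a * c + b * d + (m * z * c + n * z * d) := fun p a b m n z c d => by ring
    refine ⟨fun z => ((z.1.1.1, @HAdd.hAdd ℝ ℝ ℝ _ z.1.1.2
      (@HMul.hMul ℝ ℝ ℝ _ (S.den2 (S.d₁ g) γ.1.2 γ.2) z.2)), @HAdd.hAdd ℝ ℝ ℝ _ z.1.2
      (@HMul.hMul ℝ ℝ ℝ _ (S.den2 (S.d₂ g) γ.1.2 γ.2) z.2)),
      (isDifferential_op2 g γ).isVJP (hid _)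
        fun z c' => key _ z.1.1.2 z.1.2 _ _ z.2 c'.1.2 c'.2,
      fun {Δ v y δ} x hv hy => ?_⟩
    refine Tm.den_pair (Tm.den_pair (Tm.den_vars fun _ j => hy (.succ (.succ (.succ j))))
      ((S.den_add _ _).trans ?_)) ((S.den_add _ _).trans ?_)
    · refine congrArg₂ (fun a b : ℝ => a + b) (hy (.succ (.succ .zero))) ((S.den_mul _ _).trans ?_)
      exact congrArg₂ (fun a b : ℝ => a * b)
        (congrArg₂ (S.den2 (S.d₁ g)) (hv (.succ .zero)) (hv .zero)) (hy .zero)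
    · refine congrArg₂ (fun a b : ℝ => a + b) (hy (.succ .zero)) ((S.den_mul _ _).trans ?_)
      exact congrArg₂ (fun a b : ℝ => a * b)
        (congrArg₂ (S.den2 (S.d₂ g)) (hv (.succ .zero)) (hv .zero)) (hy .zero)
  | @fst Γ A B =>
    have key : ∀ {p a c q : ℝ} (h : q = a + (c + 0)), p + q = p + a + c :=
      fun h => by rw [h]; ring
    refine ⟨fun z => (z.1.1, STy.addV (.prod A B) z.1.2 (z.2, B.zeroV)),
      (isDifferential_fst γ).isVJP (hid _) fun z c' => key ?_, fun {Δ v y δ} x hv hy => ?_⟩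
    · exact (STy.dot_addV (.prod A B) z.1.2 (z.2, B.zeroV) c'.2).trans
        (congrArg (fun b => _ + (_ + b)) (B.dot_zeroV c'.2.2))
    · exact Tm.den_pair (Tm.den_vars fun _ j => hy (.succ (.succ j))) (Tm.den_add_of_eq (A := .prod A B)
        (Tm.den_var hy (.succ .zero)) (Tm.den_pair (Tm.den_var hy .zero) (Tm.den_zero δ B)))
  | @snd Γ A B =>
    have key : ∀ {p a c q : ℝ} (h : q = a + (0 + c)), p + q = p + a + c :=
      fun h => by rw [h]; ring
    refine ⟨fun z => (z.1.1, STy.addV (.prod A B) z.1.2 (A.zeroV, z.2)),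
      (isDifferential_snd γ).isVJP (hid _) fun z c' => key ?_, fun {Δ v y δ} x hv hy => ?_⟩
    · exact (STy.dot_addV (.prod A B) z.1.2 (A.zeroV, z.2) c'.2).trans
        (congrArg (fun b => _ + (b + _)) (A.dot_zeroV c'.2.1))
    · exact Tm.den_pair (Tm.den_vars fun _ j => hy (.succ (.succ j))) (Tm.den_add_of_eq (A := .prod A B)
        (Tm.den_var hy (.succ .zero)) (Tm.den_pair (Tm.den_zero δ A) (Tm.den_var hy .zero)))
  | @pair Γ A B =>
    refine ⟨fun z => ((z.1, z.2.1), z.2.2), (isDifferential_pair γ).isVJP (r := fun x => x.1.1)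
      (fun _ _ h => h.1.1) fun z c' => add_assoc _ _ _, fun {Δ v y δ} x hv hy => ?_⟩
    exact Tm.den_pair (Tm.den_pair (Tm.den_vars fun _ j => hy (.succ j))
      (congrArg Prod.fst (Tm.den_var hy .zero))) (congrArg Prod.snd (Tm.den_var hy .zero))
  | @map2 Γ n e =>
    choose G h using fun i : Fin n => e.exists_directSpec hp (Ren.id _)
      (Γ' := Γ ▹ .real ▹ .real) ((γ.1.1, γ.1.2 i), γ.2 i)
    let w := fun i => G i (SCtx.zeroV (Γ ▹ .real ▹ .real), (1 : ℝ))
    have hw : ∀ i : Fin n, IsGrad (Γ := Γ ▹ .real ▹ .real) e.den ((γ.1.1, γ.1.2 i), γ.2 i) (w i) :=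
      fun i => (funext fun x => congrArg e.den (SCtx.pull_id x) :
        (fun x => e.den (SCtx.pull (Ren.id _) x)) = e.den) ▸ (h i).1.isGrad
    have key : ∀ {p q r : ℝ} {p₁ p₂ q₁ q₂ r₁ r₂ : ℝ}, p = p₁ + p₂ → q = q₁ + q₂ → r = r₁ + r₂ →
        p + q + r = p₁ + q₁ + r₁ + (p₂ + q₂ + r₂) := fun h₁ h₂ h₃ => by rw [h₁, h₂, h₃]; ring
    refine ⟨fun z => ((SCtx.addV Γ z.1.1.1
        (foldArr Γ.addV Γ.zeroV n fun i => Γ.smulV (z.2 i) (w i).1.1),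
        STy.addV (.arr n) z.1.1.2 fun i => @HMul.hMul ℝ ℝ ℝ _ (w i).1.2 (z.2 i)),
        STy.addV (.arr n) z.1.2 fun i => @HMul.hMul ℝ ℝ ℝ _ (w i).2 (z.2 i)),
      (isDifferential_map2 hw).isVJP (hid _) fun z c' => key (SCtx.dot_addV Γ _ _ _)
        (STy.dot_addV (.arr n) _ _ _) (STy.dot_addV (.arr n) _ _ _),
      fun {Δ v y δ} x hv hy => ?_⟩
    have hv' : (v.precomp (Ren.id Γ).wk.wk).Sel γ.1.1 δ := fun _ i => hv (.succ (.succ i))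
    have hg := fun i => (h i).den_runGrad
      ((hv'.lift (B := .real) (γ.1.2 i)).lift (B := .real) (γ.2 i))
    have hA := Tm.den_var (S := S) hv (.succ .zero)
    have hB := Tm.den_var (S := S) hv .zero
    have hZ := Tm.den_var (S := S) hy .zero
    exact Tm.den_pair (Tm.den_pair
      (Tm.den_addC_of_eq (Tm.den_vars fun _ j => hy (.succ (.succ (.succ j))))
        (Tm.den_map2BackΓ hA hB hZ hg))
      (Tm.den_add_of_eq (A := .arr n) (Tm.den_var hy (.succ (.succ .zero)))
        (Tm.den_map2Back₁ hA hB hZ hg)))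
      (Tm.den_add_of_eq (A := .arr n) (Tm.den_var hy (.succ .zero))
        (Tm.den_map2Back₂ hA hB hZ hg))
  | @reduce Γ n e₁ e₂ =>
    choose G h using fun x y : ℝ => e₁.exists_directSpec hp.1 (Ren.id _) ((PUnit.unit, x), y)
    let m : ℝ → ℝ → ℝ := fun x y => e₁.den ((PUnit.unit, x), y)
    let w := fun x y : ℝ => G x y (SCtx.zeroV (.nil ▹ .real ▹ .real), (1 : ℝ))
    have hw : ∀ x y : ℝ, IsGrad (Γ := .nil ▹ .real ▹ .real) e₁.den ((PUnit.unit, x), y) (w x y) :=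
      fun x y => (funext fun x => congrArg e₁.den (SCtx.pull_id x) :
        (fun x => e₁.den (SCtx.pull (Ren.id _) x)) = e₁.den) ▸ (h x y).1.isGrad
    have key : ∀ {p q q₁ q₂ : ℝ}, q = q₁ + q₂ → p + q = p + q₁ + q₂ :=
      fun h => by rw [h, add_assoc]
    refine ⟨fun z => (z.1.1, STy.addV (.arr n) z.1.2 _),
      ((isDifferential_reduce hw (e₂.den γ.1) γ γ.2 rfl).isVJP (hid _) fun z c' =>
        key (STy.dot_addV (.arr n) _ _ _)).congr fun x => Prod.ext rfl (foldArr_congr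
          (fun _ _ => rfl) (hp.2 _ _) fun _ => rfl), fun {Δ v y δ} x hv hy => ?_⟩
    have hv' : (v.precomp (Ren.id Γ).wk).Sel γ.1 δ := fun _ i => hv (.succ i)
    have hE := fun x y : ℝ =>
      ((SRen.sel_empty δ).lift (B := .real) x).lift (B := .real) y
    exact Tm.den_pair (Tm.den_vars fun _ j => hy (.succ (.succ j)))
      (Tm.den_add_of_eq (A := .arr n) (Tm.den_var hy (.succ .zero))
        (Tm.den_reduceBack (Tm.den_reduceTape (m := m) (w := w) (fun x y => e₁.den_toTm (hE x y))
          (fun x y => (h x y).den_runGrad (hE x y)) (e₂.den_toTm hv') (Tm.den_var hv .zero))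
          (Tm.den_var hy .zero)))
  | @proj Γ Θ A =>
    refine ⟨fun z => (SCtx.padV Θ z.1, z.2), fun c c' _ hc => ⟨(SCtx.dropV Θ c'.1, c'.2),
      ⟨SCtx.hasVel_dropV Θ hc.1, hc.2⟩, fun z => congrArg (· + _) (SCtx.dot_padV Θ _ _)⟩,
      fun {Δ v y δ} x hv hy => ?_⟩
    exact Tm.den_pair ((Tm.den_padZero δ Θ _).trans (congrArg (SCtx.padV Θ)
      (Tm.den_vars fun _ j => hy (.succ j)))) (Tm.den_var hy .zero)

end Prim

/-! ### Unary normal forms -/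

namespace UNF

variable {S : Signature.{u}}

/-- Denotation of unary normal forms. -/
def den {Γ Δ : SCtx} : UNF S Γ Δ → TCtx.Env Γ.emb → TCtx.Env Δ.emb
  | prim p => p.den
  | seq u v => fun γ => v.den (u.den γ)

/-- The assumption on `reduce` for all primitives of a unary normal form. -/
def ReduceOK {Γ Δ : SCtx} : UNF S Γ Δ → Prop
  | prim p => p.ReduceOK
  | seq u v => u.ReduceOK ∧ v.ReduceOK

/-- Reverse mode sends a unary normal form with continuation variable `Y` to its value and the
composition of `Y` with the transposed derivative. -/
theorem exists_revD_spec {Γ Δ : SCtx} (u : UNF S Γ Δ) (hu : u.ReduceOK) (ρ : Ty)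
    (γ : TCtx.Env Γ.emb) : ∃ G, IsVJP u.den γ G ∧
      ∀ Y : (Ty.fn (tup Γ.emb) ρ).den, ∃ Z : (Ty.fn (tup Δ.emb) ρ).den,
        (revD ρ u).toTm.den (γ, Y) = (u.den γ, Z) ∧
        ∀ x, SmoothMap.toFun Z x = SmoothMap.toFun Y (G x) := by
  induction u with
  | @prim Γ Δ p =>
    obtain ⟨G, hG, h⟩ := p.exists_jacSpec hu γ
    refine ⟨G, hG, fun Y => ⟨_, Tm.den_pair (p.den_toTm ((SRen.sel_id γ).wk
      (B := .fn (tup Γ.emb) ρ) Y)) rfl, fun x => ?_⟩⟩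
    -- The body of the abstraction for `Y ∘ J^T p` still sees the point `γ` and the continuation `Y`
    -- below its bound cotangent `x`.
    have hs : (Ren.inl (Γ := revCtx ρ Γ) Δ.emb).Sel (γ, Y)
      (appendEnv (Γ := revCtx ρ Γ) Δ.emb (γ, Y) x) := Ren.sel_inl _ _ _
    refine congrArg₂ SmoothMap.toFun (Tm.den_rename Tm.v0 hs) ?_
    exact h x (((SRen.sel_id γ).wk (B := .fn (tup Γ.emb) ρ) Y).andThen hs)
      ((SRen.sel_id x).andThen (Ren.sel_inr _ _ _))
  | @seq Γ Δ Θ u v ihu ihv =>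
    obtain ⟨G, hG, h⟩ := ihu hu.1 γ
    obtain ⟨H, hH, k⟩ := ihv hu.2 (u.den γ)
    refine ⟨_, hH.comp hG, fun Y => ?_⟩
    obtain ⟨Z, hZ, hZ'⟩ := h Y
    obtain ⟨W, hW, hW'⟩ := k Z
    refine ⟨W, ?_, fun x => (hW' x).trans (hZ' _)⟩
    -- The `let` for sequential composition binds the whole output of `u`, and `v` refers to those
    -- variables only.
    refine ((revD ρ v).toTm.den_rename (Ren.sel_inr (Γ := revCtx ρ Γ) (γ, Y) (revCtx ρ Δ)
      ((revD ρ u).toTm.den (γ, Y)))).trans ?_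
    exact (congrArg (revD ρ v).toTm.den hZ).trans hW

end UNF

/-! ### Semantics of the translation to unary normal form. -/

namespace Src

variable {S : Signature.{u}}

theorem reduceOK_unfIn {Γ : SCtx} {A : STy} (e : Src S Γ A) (he : e.ReduceOK) :
    ∀ {Δ : SCtx} (s : Ren Γ Δ), (e.unfIn s).ReduceOK := by
  induction e with
  | var i => exact fun _ => trivial
  | cst c => exact fun _ => trivial
  | let_ e₁ e₂ ih₁ ih₂ => exact fun s => ⟨ih₁ he.1 s, ih₂ he.2 s.lift, trivial⟩
  | pair e₁ e₂ ih₁ ih₂ => exact fun s => ⟨ih₁ he.1 s, ih₂ he.2 s.wk, trivial⟩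
  | fst e ih => exact fun s => ⟨ih he s, trivial, trivial⟩
  | snd e ih => exact fun s => ⟨ih he s, trivial, trivial⟩
  | op1 f e ih => exact fun s => ⟨ih he s, trivial, trivial⟩
  | op2 g e₁ e₂ ih₁ ih₂ => exact fun s => ⟨ih₁ he.1 s, ih₂ he.2 s.wk, trivial, trivial⟩
  | map2 e₁ e₂ e₃ ih₁ ih₂ ih₃ =>
    exact fun s => ⟨ih₂ he.2.1 s, ih₃ he.2.2 s.wk, he.1.rename _, trivial⟩
  | reduce e₁ e₂ e₃ ih₁ ih₂ ih₃ =>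
    refine fun s => ⟨ih₃ he.2.2.2 s, ⟨he.2.1, fun γ γ' => ?_⟩, trivial⟩
    exact (e₂.den_rename s γ).trans ((he.den_unit _ _).trans (e₂.den_rename s γ').symm)

/-- The closing `proj` removes the argument values, so the net effect is to append one value to an
unchanged context. -/
theorem den_unfIn {Γ : SCtx} {A : STy} (e : Src S Γ A) : ∀ {Δ : SCtx} (s : Ren Γ Δ)
    (δ : TCtx.Env Δ.emb), (e.unfIn s).den δ = (δ, e.den (SCtx.pull s δ)) := by
  induction e with
  | var i => exact fun s δ => Prod.ext rfl (SCtx.get_pull s i δ).symm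
  | cst c => exact fun _ _ => rfl
  | let_ e₁ e₂ ih₁ ih₂ =>
    intro Δ s δ
    have h := (congrArg (e₂.unfIn s.lift).den (ih₁ s δ)).trans (ih₂ s.lift _)
    exact Prod.ext (congrArg (fun x => x.1.1) h) ((congrArg Prod.snd h).trans
      (congrArg e₂.den (SCtx.pull_lift s δ _)))
  | pair e₁ e₂ ih₁ ih₂ =>
    intro Δ s δ
    have h := (congrArg (e₂.unfIn s.wk).den (ih₁ s δ)).trans (ih₂ s.wk _)
    exact Prod.ext (congrArg (fun x => x.1.1) h) (Prod.ext (congrArg (fun x => x.1.2) h)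
      ((congrArg Prod.snd h).trans (congrArg e₂.den (SCtx.pull_wk s δ _))))
  | @fst Γ A B e ih =>
    exact fun {Δ} s δ => congrArg (fun x : TCtx.Env (SCtx.emb (Δ ▹ .prod A B)) => (x.1, x.2.1))
      (ih s δ)
  | @snd Γ A B e ih =>
    exact fun {Δ} s δ => congrArg (fun x : TCtx.Env (SCtx.emb (Δ ▹ .prod A B)) => (x.1, x.2.2))
      (ih s δ)
  | op1 f e ih =>
    exact fun {Δ} s δ => congrArg (fun x : TCtx.Env (SCtx.emb (Δ ▹ .real)) => (x.1, S.den1 f x.2))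
      (ih s δ)
  | op2 g e₁ e₂ ih₁ ih₂ =>
    intro Δ s δ
    have h := (congrArg (e₂.unfIn s.wk).den (ih₁ s δ)).trans (ih₂ s.wk _)
    refine (congrArg (fun x : TCtx.Env (SCtx.emb (Δ ▹ .real ▹ .real)) =>
      (x.1.1, S.den2 g x.1.2 x.2)) h).trans ?_
    exact congrArg (fun y => (δ, S.den2 g _ (e₂.den y))) (SCtx.pull_wk s δ _)
  | @map2 Γ n e₁ e₂ e₃ ih₁ ih₂ ih₃ =>
    intro Δ s δ
    have h := (congrArg (e₃.unfIn s.wk).den (ih₂ s δ)).trans (ih₃ s.wk _)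
    refine Prod.ext (congrArg (fun x => x.1.1) h) (funext fun i => ?_)
    refine (congrArg (fun x : TCtx.Env (SCtx.emb (Δ ▹ .arr n ▹ .arr n)) =>
      (e₁.rename s.lift.lift).den ((x.1.1, x.1.2 i), x.2 i)) h).trans ?_
    refine (e₁.den_rename _ _).trans (congrArg e₁.den ((SCtx.pull_lift₂ s δ _ _).trans ?_))
    exact congrArg (fun y => ((SCtx.pull s δ, e₂.den (SCtx.pull s δ) i), e₃.den y i))
      (SCtx.pull_wk s δ _)
  | @reduce Γ n e₁ e₂ e₃ ih₁ ih₂ ih₃ =>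
    intro Δ s δ
    refine (congrArg (fun x : TCtx.Env (SCtx.emb (Δ ▹ .arr n)) =>
      (x.1, foldArr (fun a b : ℝ => e₁.den ((PUnit.unit, a), b)) ((e₂.rename s).den x.1) n x.2))
      (ih₃ s δ)).trans ?_
    exact congrArg (fun u : ℝ => (δ, foldArr (fun a b : ℝ => e₁.den ((PUnit.unit, a), b)) u n
      (e₃.den (SCtx.pull s δ)))) (e₂.den_rename s δ)

theorem den_unf {Γ : SCtx} {A : STy} (e : Src S Γ A) (γ : TCtx.Env Γ.emb) :
    e.unf.den γ = (γ, e.den γ) :=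
  (e.den_unfIn _ γ).trans (congrArg (fun x => (γ, e.den x)) (SCtx.pull_id γ))

/-- Smoothness is inherited from the target language, where denotations are smooth by construction.
-/
theorem dsmooth_den {Γ : SCtx} {A : STy} (e : Src S Γ A) : Diffeology.DSmooth e.den :=
  (funext fun γ => e.den_toTm (SRen.sel_id γ) : ((e.toTm (SRen.id Γ)).den : _ → _) = e.den) ▸
    (e.toTm (SRen.id Γ)).den.smooth

end Src

/-! ### Contexts of reals -/

theorem dsmooth_env : (n : ℕ) → {X : Type} → [DiffeologicalSpace X] → {f : X → Fin n → ℝ} →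
    (∀ i, Diffeology.DSmooth fun x => f x i) → Diffeology.DSmooth fun x => env n (f x)
  | 0 => fun _ => Diffeology.dSmooth_const
  | n + 1 => fun hf => dsmooth_mk (dsmooth_env n fun i => hf i.castSucc) (hf (Fin.last n))

theorem hasVel_env : (n : ℕ) → {c : ℝ → Fin n → ℝ} → {c' : Fin n → ℝ} →
    (∀ i, HasDerivAt (fun t => c t i) (c' i) 0) →
    SCtx.HasVel (realCtx n) (fun t => env n (c t)) (env n c')
  | 0 => fun _ => trivial
  | n + 1 => fun h => ⟨hasVel_env n fun i => h i.castSucc, h (Fin.last n)⟩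

theorem exists_env_eq : (n : ℕ) → (γ : TCtx.Env (realCtx n).emb) → ∃ x, env n x = γ
  | 0 => fun _ => ⟨Fin.elim0, rfl⟩
  | n + 1 => fun γ => by
    obtain ⟨x, hx⟩ := exists_env_eq n γ.1
    refine ⟨Fin.snoc (α := fun _ => ℝ) x γ.2, Prod.ext ?_ ?_⟩
    · refine (congrArg (env n) (funext fun i => ?_)).trans hx
      exact Fin.snoc_castSucc (α := fun _ => ℝ) _ _ i
    · exact Fin.snoc_last (α := fun _ => ℝ) _ _

theorem hasVel_env_unique : (n : ℕ) → (c : ℝ → Fin n → ℝ) → (c' d : Fin n → ℝ) →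
    (∀ i, HasDerivAt (fun t => c t i) (c' i) 0) →
    SCtx.HasVel (realCtx n) (fun t => env n (c t)) (env n d) → c' = d
  | 0 => fun _ _ _ _ _ => Subsingleton.elim _ _
  | n + 1 => fun c c' d h h' => funext fun i => by
    refine Fin.lastCases ?_ (fun j => ?_) i
    · exact (h (Fin.last n)).unique h'.2
    · exact congrFun (hasVel_env_unique n _ (fun i => c' i.castSucc) (fun i => d i.castSucc)
        (fun i => h i.castSucc) h'.1) j

theorem dot_env : (n : ℕ) → (x y : Fin n → ℝ) →
    SCtx.dot (realCtx n) (env n x) (env n y) = x ⬝ᵥ y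
  | 0 => fun _ _ => (Finset.sum_empty).symm
  | n + 1 => fun x y => by
    refine Eq.trans ?_ (Fin.sum_univ_castSucc fun i => x i * y i).symm
    exact congrArg (· + _) (dot_env n _ _)

theorem env_pairIdDen {S : Signature.{u}} {n : ℕ} (e : Src S (realCtx n) .real) (x : Fin n → ℝ) :
    env (n + 1) (pairIdDen e x) = (env n x, e.den (env n x)) :=
  Prod.ext (congrArg (env n) (funext fun i => Fin.snoc_castSucc (α := fun _ => ℝ) _ _ i))
    (Fin.snoc_last (α := fun _ => ℝ) _ _)

/-- Diffeological and ordinary smoothness agree on Euclidean space; the linear equivalence with `Fin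
n → ℝ` transports the result. -/
theorem contDiff_pairIdDen {S : Signature.{u}} {n : ℕ} (e : Src S (realCtx n) .real) :
    ContDiff ℝ ∞ (pairIdDen e) := by
  refine contDiff_pi.2 fun i => Fin.lastCases ?_ (fun j => ?_) i
  · have h : Diffeology.DSmooth fun t : EuclideanSpace ℝ (Fin n) => e.den (env n t) :=
      e.dsmooth_den.comp (dsmooth_env n fun i =>
        ContDiff.dSmooth (EuclideanSpace.proj (𝕜 := ℝ) i).contDiff)
    have h' : ContDiff ℝ ∞ (F := ℝ) fun t : EuclideanSpace ℝ (Fin n) => e.den (env n t) :=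
      Diffeology.DSmooth.contDiff (Y := ℝ) h
    have heq : (fun x => pairIdDen e x (Fin.last n)) =
        (fun t : EuclideanSpace ℝ (Fin n) => e.den (env n t)) ∘
          (EuclideanSpace.equiv (Fin n) ℝ).symm :=
      funext fun x => Fin.snoc_last (α := fun _ => ℝ) _ _
    rw [heq]
    exact h'.comp (EuclideanSpace.equiv (Fin n) ℝ).symm.contDiff
  · have heq : (fun x => pairIdDen e x j.castSucc) = fun x => x j :=
      funext fun x => Fin.snoc_castSucc (α := fun _ => ℝ) _ _ j
    rw [heq]
    exact contDiff_apply ℝ ℝ j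

/-- The transposed derivative of `⟨Id, ⟦e⟧⟩` is multiplication by the transposed Jacobian. -/
theorem IsVJP.eq_jacobian {S : Signature.{u}} {n : ℕ} {e : Src S (realCtx n) .real}
    {x : Fin n → ℝ} {G : TCtx.Env (realCtx (n + 1)).emb → TCtx.Env (realCtx n).emb}
    (hG : IsVJP (Δ := realCtx (n + 1)) (fun γ => (γ, e.den γ)) (env n x) G)
    (w : Fin (n + 1) → ℝ) :
    G (env (n + 1) w) = env n ((jacobian (pairIdDen e) x)ᵀ *ᵥ w) := by
  obtain ⟨g, hg⟩ := exists_env_eq n (G (env (n + 1) w))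
  rw [← hg]
  refine congrArg (env n) (funext fun j => ?_)
  -- The coordinate line through `x` in direction `j`; its image under `pairIdDen e` has column `j`
  -- of the Jacobian as velocity.
  have hline : HasDerivAt (fun t : ℝ => x + t • Pi.single j (1 : ℝ)) (Pi.single j (1 : ℝ)) 0 := by
    simpa using ((hasDerivAt_id (0 : ℝ)).smul_const (Pi.single j (1 : ℝ))).const_add x
  have h0 : x + (0 : ℝ) • Pi.single j (1 : ℝ) = x := by simp
  obtain ⟨d, hd, hdot⟩ := hG _ _ (congrArg (env n) h0) (hasVel_env n (hasDerivAt_pi.1 hline))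
  obtain ⟨d, rfl⟩ := exists_env_eq (n + 1) d
  have hf : HasFDerivAt (pairIdDen e) (fderiv ℝ (pairIdDen e) x)
      (x + (0 : ℝ) • Pi.single j (1 : ℝ)) := by
    rw [h0]
    exact ((contDiff_pairIdDen e).differentiable (by simp) x).hasFDerivAt
  have hcurve := HasFDerivAt.comp_hasDerivAt (0 : ℝ) hf hline
  -- The velocity supplied by `hG` and the one from the Fréchet derivative belong to the same curve,
  -- so they agree.
  have hd' : fderiv ℝ (pairIdDen e) x (Pi.single j 1) = d := by
    refine hasVel_env_unique (n + 1) _ _ _ (hasDerivAt_pi.1 hcurve) ?_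
    have : (fun t : ℝ => env (n + 1) ((pairIdDen e ∘ fun t : ℝ => x + t • Pi.single j (1 : ℝ)) t)) =
      fun t => (env n (x + t • Pi.single j (1 : ℝ)), e.den (env n (x + t • Pi.single j (1 : ℝ)))) :=
      funext fun t => env_pairIdDen e _
    rw [this]
    exact hd
  -- Pairing with the basis vector `j` reads off coordinate `j` of `g`, which is therefore the
  -- product of `w` with column `j`.
  have key := hdot (env (n + 1) w)
  rw [← hg, dot_env, dotProduct_single, mul_one] at key
  rw [key]
  refine (dot_env (n + 1) w d).trans ?_
  rw [← hd', Matrix.mulVec, dotProduct_comm]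
  rfl

end RevAD

theorem mainTheorem5 (S : RevAD.Signature.{u}) (n : ℕ) (e : RevAD.Src S (RevAD.realCtx n) .real)
    (he : e.ReduceOK) (x : Fin n → ℝ) :
    ContDiff ℝ ∞ (RevAD.pairIdDen e) ∧
    ∀ w : Fin (n + 1) → ℝ,
      RevAD.SmoothMap.toFun
          ((RevAD.backprop e).den
            (RevAD.env n x, RevAD.SmoothMap.id (RevAD.TCtx.Env (RevAD.realCtx n).emb)))
          (RevAD.env (n + 1) w) =
        RevAD.env n ((RevAD.jacobian (RevAD.pairIdDen e) x)ᵀ *ᵥ w) := by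
  refine ⟨RevAD.contDiff_pairIdDen e, fun w => ?_⟩
  obtain ⟨G, hG, h⟩ := e.unf.exists_revD_spec (e.reduceOK_unfIn he _)
    (RevAD.tup (RevAD.realCtx n).emb) (RevAD.env n x)
  obtain ⟨Z, hZ, hZ'⟩ := h (RevAD.SmoothMap.id (RevAD.TCtx.Env (RevAD.realCtx n).emb))
  -- The projections in `backprop` unfold to the last component of the compiled tuple, namely `Z`;
  -- with the identity as `Y` its values are those of `G`.
  refine (congrArg (fun p => RevAD.SmoothMap.toFun p.2 (RevAD.env (n + 1) w)) hZ).trans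
    ((hZ' _).trans ?_)
  exact (hG.congr e.den_unf).eq_jacobian w
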